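/- Let $m>0$ and let $p_1,p_2,q\in L^2(\mathbb R_+)$ be real-valued functions such that, for $V=\begin{pmatrix}p_1&q\\ q&p_2\end{pmatrix}$, the (essential) support $\operatorname{supp}V=\operatorname{supp}p_1\cup\operatorname{supp}p_2\cup\operatorname{supp}q$ is contained in $[0,\gamma]$, where $\gamma=\sup\operatorname{supp}V\in(0,\infty)$. Let $H$ be the Dirac operator in $L^2(\mathbb R_+)\oplus L^2(\mathbb R_+)$ $$Hf=\begin{pmatrix}(m+p_1)f_1-f_2'+qf_2\\ f_1'+qf_1+(-m+p_2)f_2\end{pmatrix},\qquad f_1,f_2\in H^1(\mathbb R_+),\quad f_1(0)=0 .$$ For a nonzero continuous, compactly supported $h:[0,\infty)\to\mathbb C^2$, the function $G_h(\lambda)=((H-\lambda)^{-1}h,h)$, $\operatorname{Im}\lambda>0$, has a meromorphic continuation to $\Lambda=\mathbb C\setminus[-m,m]$, again denoted $G_h$. Let $g_+$ and $g_-$ be the upper and the lower rim of the cut $(-m,m)$; $g_+$ belongs to the physical sheet and $g_-$ to the non-physical sheet. We say that $G_h$ has a pole of order $n\ge1$ at the point of $g_\pm$ over $x\in(-m,m)$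 if, near $x$, the restriction of $G_h$ to $\{\pm\operatorname{Im}\lambda>0\}$ extends across the cut to a function that is meromorphic at $x$ and has a pole of order $n$ there. A number $x\in(-m,m)$ is called an eigenvalue of $H$ if for some such $h$ the function $G_h$ has a pole at the point of $g_+$ over $x$, and an anti-bound state if for some such $h$ the function $G_h$ has a pole at the point of $g_-$ over $x$; the multiplicity of an anti-bound state is the maximal order of this pole over all such $h$. Then: 1) If $\lambda\in(-m,m)$ is an eigenvalue of $H$, then the same number on the non-physical sheet is not an anti-bound state. 2) Let $\lambda_1<\lambda_2$ be eigenvalues of $H$ such that there are no other eigenvalues in the interval $(\lambda_1,\lambda_2)$. Then the number of anti-bound states in $(\lambda_1,\lambda_2)$ (on the non-physical sheet), counted with multiplicities, is finite, odd and $\ge1$. -/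

import Mathlib

open MeasureTheory Set Filter Topology

noncomputable section

/-- A real symmetric matrix potential `V = !![p₁, q; q, p₂]` on the half-line `[0, ∞)`.
Only the values at nonnegative arguments are ever used. -/
structure DiracPotential where
  p₁ : ℝ → ℝ
  p₂ : ℝ → ℝ
  q : ℝ → ℝ

namespace DiracPotential

/-- Lebesgue measure on the half-line `ℝ₊`. -/
abbrev halfLine : Measure ℝ := volume.restrict (Ioi 0)

/-- The (essential) support of a function on the half-line: the set of points each of whose
neighbourhoods meets `{x ≥ 0 | p x ≠ 0}` in a set of positive Lebesgue measure. -/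
def essSupport (p : ℝ → ℝ) : Set ℝ := (volume.restrict {x : ℝ | 0 ≤ x ∧ p x ≠ 0}).support

/-- `supp V = supp p₁ ∪ supp p₂ ∪ supp q`. -/
def supp (V : DiracPotential) : Set ℝ := essSupport V.p₁ ∪ essSupport V.p₂ ∪ essSupport V.q

/-- Condition A: `p₁, p₂, q ∈ L²(ℝ₊)` are real-valued and the support of `V` is bounded, with
`γ = sup supp V > 0`. -/
structure ConditionA (V : DiracPotential) : Prop where
  memLp_p₁ : MemLp V.p₁ 2 halfLine
  memLp_p₂ : MemLp V.p₂ 2 halfLine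
  memLp_q : MemLp V.q 2 halfLine
  exists_isLUB_supp : ∃ γ : ℝ, 0 < γ ∧ IsLUB V.supp γ

/-- `f` is (the continuous representative on `[0, ∞)` of) an element of the Sobolev space
`H¹(ℝ₊)`, with derivative `f'`: both are in `L²(ℝ₊)` and `f` is the primitive of `f'`. -/
structure IsH1WithDeriv (f f' : ℝ → ℂ) : Prop where
  memLp : MemLp f 2 halfLine
  memLp_deriv : MemLp f' 2 halfLine
  eq_integral : ∀ x : ℝ, 0 ≤ x → f x = f 0 + ∫ t in (0 : ℝ)..x, f' t

/-- The graph of the Dirac operator `H = -i σ₂ ∂ₓ + m σ₃ + V` in `L²(ℝ₊) ⊕ L²(ℝ₊)` with the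
boundary condition `f₁(0) = 0`: `f` lies in the domain of `H` and `H f = g`, where
`(H f)₁ = (m + p₁) f₁ - f₂' + q f₂` and `(H f)₂ = f₁' + q f₁ + (-m + p₂) f₂`. -/
def IsDirac (m : ℝ) (V : DiracPotential) (f g : ℝ → ℂ × ℂ) : Prop :=
  ∃ f₁' f₂' : ℝ → ℂ,
    IsH1WithDeriv (fun x => (f x).1) f₁' ∧ IsH1WithDeriv (fun x => (f x).2) f₂' ∧
    (f 0).1 = 0 ∧
    ∀ᵐ x ∂halfLine,
      (g x).1 = ((m : ℂ) + V.p₁ x) * (f x).1 - f₂' x + (V.q x : ℂ) * (f x).2 ∧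
      (g x).2 = f₁' x + (V.q x : ℂ) * (f x).1 + (-(m : ℂ) + V.p₂ x) * (f x).2

/-- `u = (H - z)⁻¹ h`, that is, `u` is in the domain of `H` and `H u = z u + h`. -/
def IsResolvent (m : ℝ) (V : DiracPotential) (z : ℂ) (h u : ℝ → ℂ × ℂ) : Prop :=
  IsDirac m V u (fun x => z • u x + h x)

/-- The inner product of `L²(ℝ₊) ⊕ L²(ℝ₊)`, linear in the first argument. -/
def innerL2 (u h : ℝ → ℂ × ℂ) : ℂ :=
  ∫ x, ((u x).1 * star (h x).1 + (u x).2 * star (h x).2) ∂halfLine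

/-- A nonzero element of `C₀(ℝ₊, ℂ²)`: continuous, of compact support in `[0, ∞)`, not zero. -/
structure IsTest (h : ℝ → ℂ × ℂ) : Prop where
  continuousOn : ContinuousOn h (Ici 0)
  compact : ∃ R : ℝ, ∀ x : ℝ, R < x → h x = 0
  ne_zero : ∃ x : ℝ, 0 ≤ x ∧ h x ≠ 0

/-- The cut plane `Λ = ℂ \ [-m, m]`. -/
def cutPlane (m : ℝ) : Set ℂ := {z : ℂ | ¬ (z.im = 0 ∧ z.re ∈ Icc (-m) m)}

/-- The open upper half-plane `ℂ₊`, part of the physical sheet. -/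
def upperHalf : Set ℂ := {z : ℂ | 0 < z.im}

/-- The open lower half-plane `ℂ₋`, part of the non-physical sheet. -/
def lowerHalf : Set ℂ := {z : ℂ | z.im < 0}

/-- `G` is the meromorphic continuation to `Λ = ℂ \ [-m, m]` of the function
`z ↦ ((H - z)⁻¹ h, h)` on `ℂ₊`. (As `Λ` is connected, it passes from `ℂ₊` to `ℂ₋` exactly
through `(-∞, -m)` and `(m, ∞)`.) -/
structure IsContinuation (m : ℝ) (V : DiracPotential) (h : ℝ → ℂ × ℂ) (G : ℂ → ℂ) : Prop where
  meromorphicOn : MeromorphicOn G (cutPlane m)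
  eq_resolvent : ∀ z ∈ upperHalf, ∃ u : ℝ → ℂ × ℂ, IsResolvent m V z h u ∧ G z = innerL2 u h

/-- `G` has a pole of order `n ≥ 1` at the point of the rim of the cut which lies over the real
number `x` on the side of the half-plane `U`: near `x`, the restriction of `G` to `U` extends
through the cut to a function that is meromorphic at `x` with a pole of order `n` there. -/
def HasRimPole (U : Set ℂ) (G : ℂ → ℂ) (x : ℝ) (n : ℕ) : Prop :=
  0 < n ∧ ∃ F : ℂ → ℂ, MeromorphicAt F (x : ℂ) ∧ F =ᶠ[𝓝[U] (x : ℂ)] G ∧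
    meromorphicOrderAt F (x : ℂ) = ((-(n : ℤ) : ℤ) : WithTop ℤ)

/-- For some nonzero `h ∈ C₀(ℝ₊, ℂ²)` the continuation of `((H - z)⁻¹ h, h)` has a pole of order
`n ≥ 1` at the rim point over `x`, on the side of `U`. -/
def HasStatePole (m : ℝ) (V : DiracPotential) (U : Set ℂ) (x : ℝ) (n : ℕ) : Prop :=
  ∃ h : ℝ → ℂ × ℂ, IsTest h ∧ ∃ G : ℂ → ℂ, IsContinuation m V h G ∧ HasRimPole U G x n

/-- `x` is an eigenvalue: a pole on the upper rim `g₊` of the cut `(-m, m)`. -/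
def IsEigenvalue (m : ℝ) (V : DiracPotential) (x : ℝ) : Prop :=
  x ∈ Ioo (-m) m ∧ ∃ n : ℕ, HasStatePole m V upperHalf x n

/-- `x` is an anti-bound state: a pole on the lower rim `g₋` of the cut `(-m, m)`. -/
def IsAntiBound (m : ℝ) (V : DiracPotential) (x : ℝ) : Prop :=
  x ∈ Ioo (-m) m ∧ ∃ n : ℕ, HasStatePole m V lowerHalf x n

/-- The multiplicity of an anti-bound state: the order of the pole on the lower rim, maximal
over all nonzero `h ∈ C₀(ℝ₊, ℂ²)`. -/
def antiBoundMultiplicity (m : ℝ) (V : DiracPotential) (x : ℝ) : ℕ∞ :=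
  ⨆ (n : ℕ) (_ : HasStatePole m V lowerHalf x n), (n : ℕ∞)

end DiracPotential

end

/-! Let `φ(·, z)` solve `(H - z)φ = 0` with `φ(0) = (0, 1)`; it is entire in `z`. Let `τ` satisfy
`τ² (z + m) = m - z`. Beyond `γ` the equation is free and `y₂ - τ y₁` just picks up the factor
`exp(-τ (z + m) x)`. On the physical sheet `Re (τ (z + m)) < 0`, so square integrability amounts to
`y₂ = τ y₁`. This yields `G_h = E - Q / D` with `E` entire, `Q` analytic wherever `τ` is, and the
Jost function `D = φ₂(γ) - τ φ₁(γ)` (`exists_greenFormula`); to continue `G_h` is to continue `τ`. A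
pole on a rim therefore sits at a zero of `D` and has at most its order
(`jostForm_eq_zero_of_hasStatePole`), and the order is attained for `h = (γ - t)₊ φ(t)`
(`hasStatePole_of_jostForm_eq_zero`).

On the upper and lower rims `τ = -ρ` and `τ = ρ`, where `ρ(x) = √((m - x)/(m + x))`. Eigenvalues are
the zeros of `F₊ = φ₂(γ) + ρ φ₁(γ)`, anti-bound states those of `F₋ = φ₂(γ) - ρ φ₁(γ)`. A common
zero would force `φ(γ) = 0`, which is impossible; this is 1).

For 2), the Lagrange identity and the monotonicity of `ρ` show that, at an eigenvalue `x`, the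
function `y ↦ φ₁(γ, x) F₊(y)` passes from positive to negative (`eventually_rimForm_sign`). Since
`F₊` keeps its sign between consecutive eigenvalues, `φ₁(γ)` has opposite signs at them. There `F₋ =
-2 ρ φ₁(γ)`, so `F₋` changes sign (`rimForm_mul_neg`) and has an odd number of zeros in between,
counted with multiplicity (`exists_zeros_odd`). -/

noncomputable section

/-! ### Calculus of primitives of integrable functions. -/

/-- Increments of the vector-valued primitive are dominated by those of the scalar primitive of
`‖u‖`. -/
theorem IntervalIntegrable.absolutelyContinuousOnInterval_primitive {F : Type*}
    [NormedAddCommGroup F] [NormedSpace ℝ F] {u : ℝ → F} {a b : ℝ}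
    (h : IntervalIntegrable u volume a b) :
    AbsolutelyContinuousOnInterval (fun x => ∫ t in a..x, u t) a b := by
  have h1 := h.norm.absolutelyContinuousOnInterval_intervalIntegral (c := a) (by simp)
  rw [absolutelyContinuousOnInterval_iff] at h1 ⊢
  intro ε hε
  obtain ⟨δ, hδ, H⟩ := h1 ε hε
  refine ⟨δ, hδ, fun E hE hs => lt_of_le_of_lt (Finset.sum_le_sum fun i hi => ?_) (H E hE hs)⟩
  have hm := hE.1 i hi
  have hsub : ∀ x ∈ uIcc a b, IntervalIntegrable u volume a x := fun x hx =>
    h.mono_set (uIcc_subset_uIcc (by simp) hx)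
  rw [dist_eq_norm, dist_eq_norm, intervalIntegral.integral_interval_sub_left (hsub _ hm.1)
    (hsub _ hm.2), intervalIntegral.integral_interval_sub_left (hsub _ hm.1).norm
    (hsub _ hm.2).norm]
  exact intervalIntegral.norm_integral_le_abs_integral_norm

/-- `u` is a primitive of the integrable function `u'` on `[a, b]`. -/
structure IsPrimitiveOn {F : Type*} [NormedAddCommGroup F] [NormedSpace ℝ F]
    (u u' : ℝ → F) (a b : ℝ) : Prop where
  intervalIntegrable : IntervalIntegrable u' volume a b
  eq_integral : ∀ x ∈ Icc a b, u x = u a + ∫ t in a..x, u' t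

namespace IsPrimitiveOn

section General

variable {F : Type*} [NormedAddCommGroup F] [NormedSpace ℝ F] {u u' v v' : ℝ → F} {a b c d : ℝ}

theorem mono (h : IsPrimitiveOn u u' a b) (hac : a ≤ c) (hcd : c ≤ d) (hdb : d ≤ b) :
    IsPrimitiveOn u u' c d := by
  have hsub : ∀ x ∈ Icc a b, ∀ y ∈ Icc a b, IntervalIntegrable u' volume x y := fun x hx y hy =>
    h.intervalIntegrable.mono_set (uIcc_subset_uIcc (by grind [uIcc_of_le]) (by grind [uIcc_of_le]))
  refine ⟨hsub c ⟨hac, by linarith⟩ d ⟨by linarith, hdb⟩, fun x hx => ?_⟩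
  rw [h.eq_integral x ⟨by linarith [hx.1], by linarith [hx.2]⟩,
    h.eq_integral c ⟨hac, by linarith⟩, add_assoc,
    intervalIntegral.integral_add_adjacent_intervals (hsub _ _ _ _) (hsub _ _ _ _)] <;>
  grind

theorem congr (h : IsPrimitiveOn u u' a b) (hv : ∀ x ∈ Icc a b, v x = u x)
    (hv' : ∀ᵐ x, x ∈ Ioc a b → v' x = u' x) (hab : a ≤ b) : IsPrimitiveOn v v' a b := by
  refine ⟨?_, fun x hx => ?_⟩
  · refine h.intervalIntegrable.congr_ae ?_
    rw [uIoc_of_le hab, EventuallyEq, ae_restrict_iff' measurableSet_Ioc]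
    filter_upwards [hv'] with x hx hx' using (hx hx').symm
  · rw [hv x hx, hv a ⟨le_rfl, hab⟩, h.eq_integral x hx]
    congr 1
    refine intervalIntegral.integral_congr_ae ?_
    rw [uIoc_of_le hx.1]
    filter_upwards [hv'] with t ht ht' using (ht ⟨ht'.1, ht'.2.trans hx.2⟩).symm

theorem add (h : IsPrimitiveOn u u' a b) (k : IsPrimitiveOn v v' a b) :
    IsPrimitiveOn (fun x => u x + v x) (fun x => u' x + v' x) a b := by
  refine ⟨h.intervalIntegrable.add k.intervalIntegrable, fun x hx => ?_⟩
  have hab : a ≤ b := hx.1.trans hx.2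
  rw [intervalIntegral.integral_add, h.eq_integral x hx, k.eq_integral x hx]
  · abel
  · exact (h.mono le_rfl hx.1 hx.2).intervalIntegrable
  · exact (k.mono le_rfl hx.1 hx.2).intervalIntegrable

theorem comp_clm {G : Type*} [NormedAddCommGroup G] [NormedSpace ℝ G] [CompleteSpace F]
    [CompleteSpace G] (L : F →L[ℝ] G) (h : IsPrimitiveOn u u' a b) :
    IsPrimitiveOn (fun x => L (u x)) (fun x => L (u' x)) a b := by
  refine ⟨?_, fun x hx => ?_⟩
  · exact ⟨L.integrable_comp h.intervalIntegrable.1, L.integrable_comp h.intervalIntegrable.2⟩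
  · rw [h.eq_integral x hx, map_add,
      L.intervalIntegral_comp_comm (h.mono le_rfl hx.1 hx.2).intervalIntegrable]

theorem absolutelyContinuousOnInterval (h : IsPrimitiveOn u u' a b) (hab : a ≤ b) :
    AbsolutelyContinuousOnInterval u a b := by
  have h1 := h.intervalIntegrable.absolutelyContinuousOnInterval_primitive
  have h2 : AbsolutelyContinuousOnInterval (fun x => u a + ∫ t in a..x, u' t) a b :=
    ((LipschitzWith.const (u a)).lipschitzOnWith.absolutelyContinuousOnInterval).fun_add h1
  rw [absolutelyContinuousOnInterval_iff] at h2 ⊢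
  intro ε hε
  obtain ⟨δ, hδ, H⟩ := h2 ε hε
  refine ⟨δ, hδ, fun E hE hs => ?_⟩
  have hm := hE.1
  convert H E hE hs using 1
  refine Finset.sum_congr rfl fun i hi => ?_
  have := hm i hi
  rw [uIcc_of_le hab] at this
  rw [← h.eq_integral _ this.1, ← h.eq_integral _ this.2]

theorem continuousOn (h : IsPrimitiveOn u u' a b) (hab : a ≤ b) : ContinuousOn u (Icc a b) := by
  simpa [uIcc_of_le hab] using (h.absolutelyContinuousOnInterval hab).continuousOn

variable [CompleteSpace F]

theorem ae_hasDerivAt (h : IsPrimitiveOn u u' a b) :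
    ∀ᵐ x, x ∈ Ioo a b → HasDerivAt u (u' x) x := by
  filter_upwards [h.intervalIntegrable.ae_hasDerivAt_integral] with x hx hxab
  have hab : a ≤ b := (hxab.1.trans hxab.2).le
  rw [uIcc_of_le hab] at hx
  have := (hx ⟨hxab.1.le, hxab.2.le⟩ a ⟨le_rfl, hab⟩).const_add (u a)
  refine this.congr_of_eventuallyEq ?_
  filter_upwards [Ioo_mem_nhds hxab.1 hxab.2] with y hy
  exact h.eq_integral y ⟨hy.1.le, hy.2.le⟩

/-- Subtracting the primitive of `u'` leaves an absolutely continuous function with zero derivative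
almost everywhere, hence a constant. This gives the product rule below. -/
theorem of_absolutelyContinuous (hu : AbsolutelyContinuousOnInterval u a b)
    (hu' : IntervalIntegrable u' volume a b)
    (hd : ∀ᵐ x, x ∈ Ioo a b → HasDerivAt u (u' x) x) : IsPrimitiveOn u u' a b := by
  refine ⟨hu', fun x hx => ?_⟩
  have hab : a ≤ b := hx.1.trans hx.2
  have h1 := hu'.absolutelyContinuousOnInterval_primitive
  have h2 := hu.fun_sub h1
  have hna : ∀ᵐ x : ℝ, x ≠ a := by simp [ae_iff, measure_singleton]
  have hnb : ∀ᵐ x : ℝ, x ≠ b := by simp [ae_iff, measure_singleton]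
  obtain ⟨C, hC⟩ := h2.const_of_ae_hasDerivAt_zero (by
    filter_upwards [hd, hu'.ae_hasDerivAt_integral, hna, hnb] with t h3 h4 h5 h6 h7
    have h8 : t ∈ Ioo a b := by
      rw [uIcc_of_le hab] at h7
      exact ⟨lt_of_le_of_ne h7.1 h5.symm, lt_of_le_of_ne h7.2 h6⟩
    have := (h3 h8).sub (h4 h7 a (by simp))
    rwa [sub_self] at this)
  have ha := hC a (by simp)
  have hx' := hC x (by rwa [uIcc_of_le hab])
  simp only [intervalIntegral.integral_same, sub_zero] at ha
  rw [ha, ← hx']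
  abel

end General

variable {𝕜 : Type*} [RCLike 𝕜] {u u' v v' : ℝ → 𝕜} {a b : ℝ}

theorem const_mul (w : 𝕜) (h : IsPrimitiveOn u u' a b) :
    IsPrimitiveOn (fun x => w * u x) (fun x => w * u' x) a b := by
  refine ⟨h.intervalIntegrable.const_mul w, fun x hx => ?_⟩
  rw [h.eq_integral x hx, intervalIntegral.integral_const_mul, mul_add]

theorem mul (h : IsPrimitiveOn u u' a b) (k : IsPrimitiveOn v v' a b) (hab : a ≤ b) :
    IsPrimitiveOn (fun x => u x * v x) (fun x => u' x * v x + u x * v' x) a b := by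
  refine of_absolutelyContinuous
    ((h.absolutelyContinuousOnInterval hab).fun_smul (k.absolutelyContinuousOnInterval hab)) ?_ ?_
  · refine (h.intervalIntegrable.mul_continuousOn ?_).add (k.intervalIntegrable.continuousOn_mul ?_)
    · simpa [uIcc_of_le hab] using k.continuousOn hab
    · simpa [uIcc_of_le hab] using h.continuousOn hab
  · filter_upwards [h.ae_hasDerivAt, k.ae_hasDerivAt] with x h1 h2 h3
    exact (h1 h3).mul (h2 h3)

theorem pow (h : IsPrimitiveOn u u' a b) (hab : a ≤ b) (n : ℕ) :
    IsPrimitiveOn (fun x => u x ^ (n + 1)) (fun x => (n + 1) * (u' x * u x ^ n)) a b := by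
  induction n with
  | zero => simpa using h
  | succ n ih =>
    refine (ih.mul h hab).congr (fun x _ => by ring) (Eventually.of_forall fun x _ => ?_) hab
    push_cast
    ring

end IsPrimitiveOn

/-! ### Volterra equations depending affinely on a parameter. -/

open scoped BoundedContinuousFunction

section Volterra

variable {E F : Type*} [NormedAddCommGroup E] [NormedSpace ℂ E]
  [NormedAddCommGroup F] [NormedSpace ℂ F]

theorem MeasureTheory.Integrable.apply_boundedContinuous {A : ℝ → E →L[ℂ] F} (hA : Integrable A)
    (f : ℝ →ᵇ E) : Integrable fun t => A t (f t) := by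
  refine (hA.norm.mul_const ‖f‖).mono'
    ((ContinuousLinearMap.id ℂ (E →L[ℂ] F)).aestronglyMeasurable_comp₂ hA.aestronglyMeasurable
      f.continuous.aestronglyMeasurable) (Eventually.of_forall fun t => ?_)
  exact (A t).le_opNorm_of_le (f.norm_coe_le_norm t)

theorem norm_integral_apply_le {A : ℝ → E →L[ℂ] F} (hA : Integrable A) (f : ℝ →ᵇ E) (x : ℝ) :
    ‖∫ t in (0 : ℝ)..x, A t (f t)‖ ≤ (∫ t, ‖A t‖) * ‖f‖ := by
  rw [← integral_mul_const]
  refine intervalIntegral.norm_integral_le_integral_norm_uIoc.trans ?_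
  refine (setIntegral_le_integral (hA.apply_boundedContinuous f).norm
    (Eventually.of_forall fun t => norm_nonneg _)).trans ?_
  exact integral_mono (hA.apply_boundedContinuous f).norm (hA.norm.mul_const _)
    fun t => (A t).le_opNorm_of_le (f.norm_coe_le_norm t)

/-- The Volterra operator `f ↦ ∫₀ˣ A(t) f(t) dt` on bounded continuous functions. -/
def volterra (A : ℝ → E →L[ℂ] F) (hA : Integrable A) : (ℝ →ᵇ E) →L[ℂ] (ℝ →ᵇ F) :=
  LinearMap.mkContinuous
    { toFun := fun f => BoundedContinuousFunction.ofNormedAddCommGroup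
        (fun x => ∫ t in (0 : ℝ)..x, A t (f t))
        (intervalIntegral.continuous_primitive
          (fun _ _ => (hA.apply_boundedContinuous f).intervalIntegrable) 0)
        ((∫ t, ‖A t‖) * ‖f‖) (norm_integral_apply_le hA f)
      map_add' := fun f g => by
        ext x
        simp only [BoundedContinuousFunction.coe_add, Pi.add_apply, map_add,
          BoundedContinuousFunction.coe_ofNormedAddCommGroup]
        exact intervalIntegral.integral_add (hA.apply_boundedContinuous f).intervalIntegrable
          (hA.apply_boundedContinuous g).intervalIntegrable
      map_smul' := fun c f => by
        ext x
        simp [intervalIntegral.integral_smul] }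
    (∫ t, ‖A t‖)
    (fun f => (BoundedContinuousFunction.norm_le
      (mul_nonneg (integral_nonneg fun _ => norm_nonneg _) (norm_nonneg _))).2
        (norm_integral_apply_le hA f))

theorem volterra_apply (A : ℝ → E →L[ℂ] F) (hA : Integrable A) (f : ℝ →ᵇ E) (x : ℝ) :
    volterra A hA f x = ∫ t in (0 : ℝ)..x, A t (f t) := rfl

/-- With `α(x) = ∫₀ˣ ‖A‖`, the induction step is `∫₀ˣ α' αⁿ = αⁿ⁺¹ / (n + 1)`. For `x < 0` both
integrals vanish, because `A` does. -/
theorem norm_volterra_pow_apply_le {A : ℝ → E →L[ℂ] E} (hA : Integrable A)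
    (h0 : ∀ t < 0, A t = 0) (f : ℝ →ᵇ E) (n : ℕ) (x : ℝ) :
    ‖((volterra A hA) ^ n) f x‖ ≤ ‖f‖ * ((∫ t in (0 : ℝ)..x, ‖A t‖) ^ n / n.factorial) := by
  induction n generalizing x with
  | zero => simpa using f.norm_coe_le_norm x
  | succ n ih =>
    rw [pow_succ', mul_apply_eq_comp, volterra_apply]
    rcases lt_or_ge x 0 with hx | hx
    · have hz : ∀ᵐ t : ℝ, t ∈ uIoc 0 x → A t = 0 := by
        have : ∀ᵐ t : ℝ, t ≠ 0 := by simp [ae_iff, measure_singleton]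
        filter_upwards [this] with t ht ht'
        rw [uIoc_of_ge hx.le] at ht'
        exact h0 t (lt_of_le_of_ne ht'.2 ht)
      rw [intervalIntegral.integral_zero_ae (hz.mono fun t ht ht' => by rw [ht ht']; rfl),
        intervalIntegral.integral_zero_ae (hz.mono fun t ht ht' => by rw [ht ht', norm_zero])]
      simp
    · have hα : IsPrimitiveOn (fun x => ∫ t in (0 : ℝ)..x, ‖A t‖) (fun t => ‖A t‖) 0 x :=
        ⟨hA.norm.intervalIntegrable, by simp⟩
      have hp := hα.pow hx n
      have hpx := hp.eq_integral x ⟨hx, le_rfl⟩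
      simp only [intervalIntegral.integral_same, ne_eq, Nat.add_eq_zero_iff, one_ne_zero,
        and_false, not_false_eq_true, zero_pow, zero_add] at hpx
      rw [hpx, intervalIntegral.integral_const_mul]
      have hi : IntervalIntegrable
          (fun t => ‖A t‖ * (∫ s in (0 : ℝ)..t, ‖A s‖) ^ n) volume 0 x := by
        refine hA.norm.intervalIntegrable.mul_continuousOn (Continuous.continuousOn ?_)
        exact (intervalIntegral.continuous_primitive
          (fun _ _ => hA.norm.intervalIntegrable) 0).pow n
      have hle : ‖∫ t in (0 : ℝ)..x, A t (((volterra A hA) ^ n) f t)‖ ≤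
          ∫ t in (0 : ℝ)..x, (‖f‖ / n.factorial) *
            (‖A t‖ * (∫ s in (0 : ℝ)..t, ‖A s‖) ^ n) := by
        refine intervalIntegral.norm_integral_le_of_norm_le hx
          (Eventually.of_forall fun t _ => ?_) (hi.const_mul _)
        refine ((A t).le_opNorm_of_le (ih t)).trans (le_of_eq ?_)
        ring
      refine hle.trans (le_of_eq ?_)
      rw [intervalIntegral.integral_const_mul, Nat.factorial_succ]
      push_cast
      have : (n.factorial : ℝ) ≠ 0 := by positivity
      field_simp

/-- By the factorial bound some power `Kⁿ` has norm below one, so `1 - Kⁿ` is invertible. It is the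
product of `1 - K` and a geometric sum commuting with it, so `1 - K` is invertible too. -/
theorem isUnit_one_sub_volterra [CompleteSpace E] {A : ℝ → E →L[ℂ] E} (hA : Integrable A)
    (h0 : ∀ t < 0, A t = 0) : IsUnit (1 - volterra A hA) := by
  set a := ∫ t, ‖A t‖ with ha
  have ha0 : 0 ≤ a := integral_nonneg fun _ => norm_nonneg _
  have hprim : ∀ x, |∫ t in (0 : ℝ)..x, ‖A t‖| ≤ a := fun x => by
    have h1 := intervalIntegral.norm_integral_le_integral_norm_uIoc (f := fun t => ‖A t‖)
      (a := 0) (b := x) (μ := volume)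
    simp only [Real.norm_eq_abs, abs_norm] at h1
    exact h1.trans (setIntegral_le_integral hA.norm (Eventually.of_forall fun t => norm_nonneg _))
  obtain ⟨n, hn⟩ := ((FloorSemiring.tendsto_pow_div_factorial_atTop a).eventually
    (gt_mem_nhds one_pos)).exists
  have hnorm : ‖(volterra A hA) ^ n‖ < 1 := by
    refine lt_of_le_of_lt (ContinuousLinearMap.opNorm_le_bound _ (by positivity) fun f => ?_) hn
    refine (BoundedContinuousFunction.norm_le (by positivity)).2 fun x => ?_
    refine (norm_volterra_pow_apply_le hA h0 f n x).trans ?_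
    rw [mul_comm]
    refine mul_le_mul_of_nonneg_right (div_le_div_of_nonneg_right ?_ (by positivity))
      (norm_nonneg _)
    refine (le_abs_self _).trans ?_
    rw [abs_pow]
    exact pow_le_pow_left₀ (abs_nonneg _) (hprim x) n
  have hu : IsUnit (1 - (volterra A hA) ^ n) := isUnit_one_sub_of_norm_lt_one hnorm
  rw [← mul_neg_geom_sum] at hu
  refine ((Commute.isUnit_mul_iff ?_).1 hu).1
  exact Commute.sub_left (Commute.one_left _)
    (Commute.sum_right _ _ _ fun i _ => (Commute.refl _).pow_right i)

theorem volterra_add_smul {A B : ℝ → E →L[ℂ] F} (hA : Integrable A) (hB : Integrable B) (z : ℂ) :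
    volterra (fun t => A t + z • B t) (hA.add (hB.smul z)) =
      volterra A hA + z • volterra B hB := by
  ext f x
  simp only [volterra_apply, add_apply, smul_apply,
    BoundedContinuousFunction.coe_add, Pi.add_apply, BoundedContinuousFunction.coe_smul]
  rw [← intervalIntegral.integral_smul, intervalIntegral.integral_add]
  · exact (hA.apply_boundedContinuous f).intervalIntegrable
  · exact ((hB.apply_boundedContinuous f).smul z).intervalIntegrable

/-- The solution of `y = f + ∫₀ˣ (A(t) + z B(t)) y(t) dt`. -/
def volterraSol (A B : ℝ → E →L[ℂ] E) (hA : Integrable A) (hB : Integrable B) (f : ℝ →ᵇ E)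
    (z : ℂ) : ℝ →ᵇ E :=
  Ring.inverse (1 - (volterra A hA + z • volterra B hB)) f

variable [CompleteSpace E] {A B : ℝ → E →L[ℂ] E} {hA : Integrable A} {hB : Integrable B}

theorem isUnit_one_sub_volterra_add (hA0 : ∀ t < 0, A t = 0) (hB0 : ∀ t < 0, B t = 0) (z : ℂ) :
    IsUnit (1 - (volterra A hA + z • volterra B hB)) := by
  rw [← volterra_add_smul]
  exact isUnit_one_sub_volterra _ fun t ht => by simp [hA0 t ht, hB0 t ht]

theorem eq_volterraSol_iff (hA0 : ∀ t < 0, A t = 0) (hB0 : ∀ t < 0, B t = 0) (f y : ℝ →ᵇ E)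
    (z : ℂ) : y = volterraSol A B hA hB f z ↔
      ∀ x, y x = f x + ∫ t in (0 : ℝ)..x, (A t + z • B t) (y t) := by
  have hu := isUnit_one_sub_volterra_add (hA := hA) (hB := hB) hA0 hB0 z
  have key : (∀ x, y x = f x + ∫ t in (0 : ℝ)..x, (A t + z • B t) (y t)) ↔
      (1 - (volterra A hA + z • volterra B hB)) y = f := by
    rw [← volterra_add_smul, sub_apply, one_apply_eq_self,
      sub_eq_iff_eq_add, BoundedContinuousFunction.ext_iff]
    rfl
  rw [key, volterraSol]
  constructor
  · rintro rfl
    rw [← mul_apply_eq_comp, Ring.mul_inverse_cancel _ hu,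
      one_apply_eq_self]
  · intro h
    rw [← h, ← mul_apply_eq_comp, Ring.inverse_mul_cancel _ hu,
      one_apply_eq_self]

/-- The operator is affine in `z` and inversion is holomorphic on units, so solutions are entire in
`z` as elements of the Banach space. -/
theorem differentiable_volterraSol (hA0 : ∀ t < 0, A t = 0) (hB0 : ∀ t < 0, B t = 0)
    (f : ℝ →ᵇ E) : Differentiable ℂ (volterraSol A B hA hB f) := by
  intro z
  have hu := isUnit_one_sub_volterra_add (hA := hA) (hB := hB) hA0 hB0 z
  have h1 : DifferentiableAt ℂ (fun z : ℂ => 1 - (volterra A hA + z • volterra B hB)) z := by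
    fun_prop
  have h2 : DifferentiableAt ℂ Ring.inverse (1 - (volterra A hA + z • volterra B hB)) := by
    obtain ⟨v, hv⟩ := hu
    rw [← hv]
    exact differentiableAt_inverse (𝕜 := ℂ) v.isUnit
  exact (DifferentiableAt.fun_comp' z h2 h1).clm_apply (differentiableAt_const f)

end Volterra

/-! ### The Dirac system on a bounded interval. -/

namespace DiracPotential

variable {m : ℝ} {V : DiracPotential} {z ζ : ℂ} {g k y w : ℝ → ℂ × ℂ} {a b c d R γ : ℝ}

/-- `y` solves `(H - z) y = g` on `[a, b]`, in the sense of absolutely continuous functions. -/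
structure IsSolOn (m : ℝ) (V : DiracPotential) (z : ℂ) (g y : ℝ → ℂ × ℂ) (a b : ℝ) : Prop where
  fst : IsPrimitiveOn (fun x => (y x).1)
    (fun x => -(V.q x : ℂ) * (y x).1 + (z + m - V.p₂ x) * (y x).2 + (g x).2) a b
  snd : IsPrimitiveOn (fun x => (y x).2)
    (fun x => ((m : ℂ) + V.p₁ x - z) * (y x).1 + (V.q x : ℂ) * (y x).2 - (g x).1) a b

/-- The Wronskian of two vector functions. -/
def wronskian (y w : ℝ → ℂ × ℂ) (x : ℝ) : ℂ := (y x).1 * (w x).2 - (y x).2 * (w x).1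

namespace IsSolOn

theorem mono (h : IsSolOn m V z g y a b) (hac : a ≤ c) (hcd : c ≤ d) (hdb : d ≤ b) :
    IsSolOn m V z g y c d :=
  ⟨h.fst.mono hac hcd hdb, h.snd.mono hac hcd hdb⟩

theorem congr (h : IsSolOn m V z g y a b) (hab : a ≤ b) (hw : ∀ x ∈ Icc a b, w x = y x) :
    IsSolOn m V z g w a b := by
  refine ⟨h.fst.congr (fun x hx => by rw [hw x hx]) (Eventually.of_forall fun x hx => ?_) hab,
    h.snd.congr (fun x hx => by rw [hw x hx]) (Eventually.of_forall fun x hx => ?_) hab⟩ <;>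
  rw [hw x (Ioc_subset_Icc_self hx)]

theorem add_smul (h : IsSolOn m V z g y a b) (k : IsSolOn m V z 0 w a b) (hab : a ≤ b) (s : ℂ) :
    IsSolOn m V z g (fun x => y x + s • w x) a b := by
  refine ⟨(h.fst.add (k.fst.const_mul s)).congr (fun x _ => by simp)
    (Eventually.of_forall fun x _ => ?_) hab, (h.snd.add (k.snd.const_mul s)).congr
    (fun x _ => by simp) (Eventually.of_forall fun x _ => ?_) hab⟩ <;>
  simp only [Prod.fst_add, Prod.snd_add, Prod.smul_fst, Prod.smul_snd, smul_eq_mul, Pi.zero_apply,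
    Prod.fst_zero, Prod.snd_zero] <;> ring

theorem sub (h : IsSolOn m V z g y a b) (k : IsSolOn m V z g w a b) (hab : a ≤ b) :
    IsSolOn m V z 0 (fun x => y x - w x) a b := by
  refine ⟨(h.fst.add (k.fst.const_mul (-1))).congr (fun x _ => ?_)
    (Eventually.of_forall fun x _ => ?_) hab, (h.snd.add (k.snd.const_mul (-1))).congr
    (fun x _ => ?_) (Eventually.of_forall fun x _ => ?_) hab⟩ <;>
  simp only [Prod.fst_sub, Prod.snd_sub, Pi.zero_apply, Prod.fst_zero, Prod.snd_zero] <;> ring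

theorem conj (h : IsSolOn m V z g y a b) (hab : a ≤ b) :
    IsSolOn m V (star z) (fun x => star (g x)) (fun x => star (y x)) a b := by
  refine ⟨(h.fst.comp_clm (Complex.conjCLE : ℂ →L[ℝ] ℂ)).congr (fun x _ => ?_)
    (Eventually.of_forall fun x _ => ?_) hab,
    (h.snd.comp_clm (Complex.conjCLE : ℂ →L[ℝ] ℂ)).congr (fun x _ => ?_)
    (Eventually.of_forall fun x _ => ?_) hab⟩ <;>
  simp [Prod.fst_star, Prod.snd_star]

/-- The potential is symmetric, so all its terms cancel in the derivative of the Wronskian.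
Uniqueness, absence of poles on the physical sheet and monotonicity in the spectral parameter all
come from this identity. -/
theorem lagrange (h : IsSolOn m V z g y a b) (hw : IsSolOn m V ζ k w a b) (hab : a ≤ b) :
    IsPrimitiveOn (wronskian y w) (fun x => (z - ζ) * ((y x).1 * (w x).1 + (y x).2 * (w x).2) +
      ((g x).1 * (w x).1 + (g x).2 * (w x).2) - ((y x).1 * (k x).1 + (y x).2 * (k x).2)) a b := by
  refine ((h.fst.mul hw.snd hab).add ((h.snd.mul hw.fst hab).const_mul (-1))).congr
    (fun x _ => ?_) (Eventually.of_forall fun x _ => ?_) hab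
  · simp only [wronskian]; ring
  · ring

theorem wronskian_eq (h : IsSolOn m V z 0 y a b) (hw : IsSolOn m V z 0 w a b) (hab : a ≤ b) :
    wronskian y w b = wronskian y w a := by
  rw [(h.lagrange hw hab).eq_integral b ⟨hab, le_rfl⟩]
  simp

end IsSolOn

/-- The constant part of the system matrix, cut off to `(0, R]`. -/
def coeffMatrix (m : ℝ) (V : DiracPotential) (R : ℝ) (t : ℝ) : (ℂ × ℂ) →L[ℂ] (ℂ × ℂ) :=
  (Ioc 0 R).indicator (fun t => (m : ℂ) + V.p₁ t) t •
      (ContinuousLinearMap.inr ℂ ℂ ℂ ∘L ContinuousLinearMap.fst ℂ ℂ ℂ) +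
    (Ioc 0 R).indicator (fun t => (m : ℂ) - V.p₂ t) t •
      (ContinuousLinearMap.inl ℂ ℂ ℂ ∘L ContinuousLinearMap.snd ℂ ℂ ℂ) +
    (Ioc 0 R).indicator (fun t => (V.q t : ℂ)) t •
      (ContinuousLinearMap.inr ℂ ℂ ℂ ∘L ContinuousLinearMap.snd ℂ ℂ ℂ -
        ContinuousLinearMap.inl ℂ ℂ ℂ ∘L ContinuousLinearMap.fst ℂ ℂ ℂ)

/-- The part of the system matrix multiplying the spectral parameter, cut off to `(0, R]`. -/
def spectralMatrix (R : ℝ) (t : ℝ) : (ℂ × ℂ) →L[ℂ] (ℂ × ℂ) :=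
  (Ioc 0 R).indicator (fun _ => (1 : ℂ)) t •
    (ContinuousLinearMap.inl ℂ ℂ ℂ ∘L ContinuousLinearMap.snd ℂ ℂ ℂ -
      ContinuousLinearMap.inr ℂ ℂ ℂ ∘L ContinuousLinearMap.fst ℂ ℂ ℂ)

theorem integrableOn_of_memLp {p : ℝ → ℝ} (hp : MemLp p 2 halfLine) (R : ℝ) :
    IntegrableOn p (Ioc 0 R) :=
  (hp.mono_measure (Measure.restrict_mono Ioc_subset_Ioi_self le_rfl)).integrable (by norm_num)

theorem integrable_coeffMatrix (hV : V.ConditionA) (R : ℝ) : Integrable (coeffMatrix m V R) := by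
  have hm : IntegrableOn (fun _ : ℝ => (m : ℂ)) (Ioc 0 R) := by simp
  have h1 : IntegrableOn (fun t => (m : ℂ) + V.p₁ t) (Ioc 0 R) :=
    hm.add (integrableOn_of_memLp hV.memLp_p₁ R).ofReal
  have h2 : IntegrableOn (fun t => (m : ℂ) - V.p₂ t) (Ioc 0 R) :=
    hm.sub (integrableOn_of_memLp hV.memLp_p₂ R).ofReal
  have h3 : IntegrableOn (fun t => (V.q t : ℂ)) (Ioc 0 R) :=
    (integrableOn_of_memLp hV.memLp_q R).ofReal
  have k1 := (h1.integrable_indicator measurableSet_Ioc).smul_const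
    (ContinuousLinearMap.inr ℂ ℂ ℂ ∘L ContinuousLinearMap.fst ℂ ℂ ℂ)
  have k2 := (h2.integrable_indicator measurableSet_Ioc).smul_const
    (ContinuousLinearMap.inl ℂ ℂ ℂ ∘L ContinuousLinearMap.snd ℂ ℂ ℂ)
  have k3 := (h3.integrable_indicator measurableSet_Ioc).smul_const
    (ContinuousLinearMap.inr ℂ ℂ ℂ ∘L ContinuousLinearMap.snd ℂ ℂ ℂ -
      ContinuousLinearMap.inl ℂ ℂ ℂ ∘L ContinuousLinearMap.fst ℂ ℂ ℂ)
  exact (k1.add k2).add k3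

theorem integrable_spectralMatrix (R : ℝ) : Integrable (spectralMatrix R) := by
  have h1 : IntegrableOn (fun _ : ℝ => (1 : ℂ)) (Ioc 0 R) := by simp
  exact (h1.integrable_indicator measurableSet_Ioc).smul_const _

/-- The coefficients are cut off to `(0, R]` so that the Volterra theory on the whole line applies;
solutions are then constant beyond `R`. -/
theorem exists_analytic_solution (hV : V.ConditionA) (hR : 0 ≤ R)
    (hg : IntegrableOn g (Ioc 0 R)) (y₀ : ℂ × ℂ) :
    ∃ Y : ℂ → (ℝ →ᵇ ℂ × ℂ), Differentiable ℂ Y ∧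
      ∀ z, IsSolOn m V z g (Y z) 0 R ∧ Y z 0 = y₀ ∧ ∀ x, R ≤ x → Y z x = Y z R := by
  set G : ℝ → ℂ × ℂ := (Ioc 0 R).indicator fun t => ((g t).2, -(g t).1) with hG
  have hGi : Integrable G := by
    rw [hG, integrable_indicator_iff measurableSet_Ioc]
    exact hg.snd.prodMk hg.fst.neg
  -- The free term of the integral equation absorbs both the initial value and the inhomogeneity.
  let F : ℝ →ᵇ ℂ × ℂ := BoundedContinuousFunction.ofNormedAddCommGroup
    (fun x => y₀ + ∫ t in (0 : ℝ)..x, G t)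
    (continuous_const.add (intervalIntegral.continuous_primitive
      (fun _ _ => hGi.intervalIntegrable) 0))
    (‖y₀‖ + ∫ t, ‖G t‖) (fun x => (norm_add_le _ _).trans (add_le_add le_rfl
      (intervalIntegral.norm_integral_le_integral_norm_uIoc.trans
        (setIntegral_le_integral hGi.norm (Eventually.of_forall fun t => norm_nonneg _)))))
  have hFx : ∀ x, F x = y₀ + ∫ t in (0 : ℝ)..x, G t := fun x => rfl
  have hA := integrable_coeffMatrix (m := m) hV R
  have hB := integrable_spectralMatrix R
  have hneg : ∀ t < 0, t ∉ Ioc 0 R := fun t ht h => absurd h.1 (not_lt.2 ht.le)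
  have hA0 : ∀ t < 0, coeffMatrix m V R t = 0 := fun t ht => by
    rw [coeffMatrix]
    simp only [indicator_of_notMem (hneg t ht)]
    ext <;> simp
  have hB0 : ∀ t < 0, spectralMatrix R t = 0 := fun t ht => by
    rw [spectralMatrix]
    simp only [indicator_of_notMem (hneg t ht)]
    ext <;> simp
  refine ⟨volterraSol _ _ hA hB F, differentiable_volterraSol hA0 hB0 F, fun z => ?_⟩
  set Y := volterraSol _ _ hA hB F z with hY
  have heq := (eq_volterraSol_iff hA0 hB0 F Y z).1 hY
  have hint : Integrable fun t => (coeffMatrix m V R t + z • spectralMatrix R t) (Y t) :=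
    (hA.add (hB.smul z)).apply_boundedContinuous Y
  have h0 : Y 0 = y₀ := by simp [heq 0, hFx]
  have hsum : ∀ x, Y x = y₀ + ∫ t in (0 : ℝ)..x,
      (G t + (coeffMatrix m V R t + z • spectralMatrix R t) (Y t)) := fun x => by
    rw [heq x, hFx, add_assoc, intervalIntegral.integral_add hGi.intervalIntegrable
      hint.intervalIntegrable]
  have hprim : IsPrimitiveOn Y
      (fun t => G t + (coeffMatrix m V R t + z • spectralMatrix R t) (Y t)) 0 R :=
    ⟨(hGi.add hint).intervalIntegrable, fun x _ => by rw [h0]; exact hsum x⟩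
  refine ⟨⟨?_, ?_⟩, h0, fun x hx => ?_⟩
  · refine (hprim.comp_clm (ContinuousLinearMap.fst ℝ ℂ ℂ)).congr (fun x _ => rfl)
      (Eventually.of_forall fun t ht => ?_) hR
    simp only [hG, coeffMatrix, spectralMatrix, indicator_of_mem ht]
    simp
    ring
  · refine (hprim.comp_clm (ContinuousLinearMap.snd ℝ ℂ ℂ)).congr (fun x _ => rfl)
      (Eventually.of_forall fun t ht => ?_) hR
    simp only [hG, coeffMatrix, spectralMatrix, indicator_of_mem ht]
    simp
    ring
  · have hii : ∀ c d, IntervalIntegrable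
        (fun t => G t + (coeffMatrix m V R t + z • spectralMatrix R t) (Y t)) volume c d :=
      fun _ _ => (hGi.add hint).intervalIntegrable
    rw [hsum x, hsum R, ← intervalIntegral.integral_add_adjacent_intervals (hii 0 R) (hii R x),
      intervalIntegral.integral_zero_ae (a := R), add_zero]
    refine Eventually.of_forall fun t ht => ?_
    rw [uIoc_of_le hx] at ht
    have hn : t ∉ Ioc 0 R := fun h => absurd h.2 (not_le.2 ht.1)
    simp [hG, coeffMatrix, spectralMatrix, indicator_of_notMem hn]

/-- The difference has zero Wronskian with each of two solutions `T`, `P` whose mutual Wronskian is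
1; Cramer's rule makes it vanish. -/
theorem IsSolOn.eq_of_eq_zero (hV : V.ConditionA) (hR : 0 ≤ R) (hy : IsSolOn m V z g y 0 R)
    (hw : IsSolOn m V z g w 0 R) (h0 : y 0 = w 0) : ∀ x ∈ Icc 0 R, y x = w x := by
  obtain ⟨T, -, hT⟩ := exists_analytic_solution (m := m) (g := 0) hV hR integrableOn_zero (1, 0)
  obtain ⟨P, -, hP⟩ := exists_analytic_solution (m := m) (g := 0) hV hR integrableOn_zero (0, 1)
  intro x hx
  have hT' := (hT z).1.mono le_rfl hx.1 hx.2
  have hP' := (hP z).1.mono le_rfl hx.1 hx.2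
  have hs := (hy.sub hw hR).mono le_rfl hx.1 hx.2
  have h1 := hT'.wronskian_eq hP' hx.1
  have h2 := hT'.wronskian_eq hs hx.1
  have h3 := hP'.wronskian_eq hs hx.1
  simp only [wronskian, (hT z).2.1, (hP z).2.1, h0, sub_self, Prod.fst_zero, Prod.snd_zero,
    Prod.fst_sub, Prod.snd_sub] at h1 h2 h3
  refine Prod.ext (sub_eq_zero.1 ?_) (sub_eq_zero.1 ?_)
  · linear_combination (-((y x).1 - (w x).1)) * h1 + (P z x).1 * h2 - (T z x).1 * h3
  · linear_combination (-((y x).2 - (w x).2)) * h1 + (P z x).2 * h2 - (T z x).2 * h3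

theorem IsSolOn.ne_zero (hV : V.ConditionA) (hR : 0 ≤ R) (hy : IsSolOn m V z 0 y 0 R)
    (h0 : y 0 = (0, 1)) : y R ≠ 0 := by
  obtain ⟨T, -, hT⟩ := exists_analytic_solution (m := m) (g := 0) hV hR integrableOn_zero (1, 0)
  have h1 := (hT z).1.wronskian_eq hy hR
  intro h
  simp [wronskian, (hT z).2.1, h0, h] at h1

/-- The functions `(y₁, y₂) ↦ y₂ - τ y₁` satisfy a scalar equation where the potential vanishes. -/
theorem IsSolOn.boundary_form (hy : IsSolOn m V z g y a b) (hab : a ≤ b)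
    (hV0 : ∀ᵐ x, x ∈ Ioc a b → V.p₁ x = 0 ∧ V.p₂ x = 0 ∧ V.q x = 0)
    (hg : ∀ x ∈ Ioc a b, g x = 0) {τ : ℂ} (hτ : τ ^ 2 * (z + m) = m - z) :
    (y b).2 - τ * (y b).1 = Complex.exp (-(τ * (z + m) * (b - a))) * ((y a).2 - τ * (y a).1) := by
  set μ := τ * (z + m) with hμ
  have hB := hy.snd.add (hy.fst.const_mul (-τ))
  have he : IsPrimitiveOn (fun x : ℝ => Complex.exp (μ * x))
      (fun x : ℝ => μ * Complex.exp (μ * x)) a b := by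
    have hd : ∀ x : ℝ, HasDerivAt (fun x : ℝ => Complex.exp (μ * x))
        (μ * Complex.exp (μ * x)) x := fun x => by
      have := (((hasDerivAt_id (x : ℂ)).const_mul μ).cexp).comp_ofReal
      simpa [mul_comm] using this
    have hc : Continuous fun x : ℝ => μ * Complex.exp (μ * x) := by fun_prop
    refine ⟨hc.intervalIntegrable _ _, fun x _ => ?_⟩
    rw [intervalIntegral.integral_eq_sub_of_hasDerivAt (fun t _ => hd t)
      (hc.intervalIntegrable _ _)]
    ring
  -- By `hτ` the free equation gives `(y₂ - τ y₁)' = -μ (y₂ - τ y₁)`, so the product with `exp(μ x)`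
  -- has zero derivative.
  have hp := (he.mul hB hab).eq_integral b ⟨hab, le_rfl⟩
  rw [intervalIntegral.integral_zero_ae, add_zero] at hp
  · have h1 : Complex.exp (-(μ * (b - a))) * Complex.exp (μ * b) = Complex.exp (μ * a) := by
      rw [← Complex.exp_add]; congr 1; ring
    have h2 := Complex.exp_ne_zero (μ * b)
    refine mul_left_cancel₀ h2 ?_
    linear_combination hp - ((y a).2 - τ * (y a).1) * h1
  · filter_upwards [hV0] with x hx hxab
    rw [uIoc_of_le hab] at hxab
    obtain ⟨h1, h2, h3⟩ := hx hxab
    simp only [h1, h2, h3, hg x hxab, hμ, Complex.ofReal_zero, Prod.fst_zero, Prod.snd_zero]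
    linear_combination (-Complex.exp (τ * (z + m) * x) * (y x).1) * hτ

end DiracPotential

/-! ### The resolvent and the boundary condition `y₂ = τ y₁` beyond the support. -/

theorem IsPrimitiveOn.trans {F : Type*} [NormedAddCommGroup F] [NormedSpace ℝ F]
    {u u' : ℝ → F} {a b c : ℝ} (h : IsPrimitiveOn u u' a b) (k : IsPrimitiveOn u u' b c)
    (hab : a ≤ b) : IsPrimitiveOn u u' a c := by
  refine ⟨h.intervalIntegrable.trans k.intervalIntegrable, fun x hx => ?_⟩
  rcases le_total x b with hxb | hxb
  · exact h.eq_integral x ⟨hx.1, hxb⟩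
  · rw [k.eq_integral x ⟨hxb, hx.2⟩, h.eq_integral b ⟨hab, le_rfl⟩, add_assoc,
      intervalIntegral.integral_add_adjacent_intervals h.intervalIntegrable
        (k.mono le_rfl hxb hx.2).intervalIntegrable]

namespace DiracPotential

variable {m : ℝ} {V : DiracPotential} {z τ : ℂ} {g y w h u : ℝ → ℂ × ℂ} {a b c R γ : ℝ}

theorem IsSolOn.trans (hy : IsSolOn m V z g y a b) (hy' : IsSolOn m V z g y b c) (hab : a ≤ b) :
    IsSolOn m V z g y a c :=
  ⟨hy.fst.trans hy'.fst hab, hy.snd.trans hy'.snd hab⟩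

theorem ae_eq_zero_of_essSupport_subset {p : ℝ → ℝ} (h0 : 0 ≤ γ) (hp : essSupport p ⊆ Iic γ) :
    ∀ᵐ x, γ < x → p x = 0 := by
  have h1 : (volume.restrict {x : ℝ | 0 ≤ x ∧ p x ≠ 0}) (Ioi γ) = 0 := by
    have hsub : Ioi γ ⊆ (essSupport p)ᶜ := fun x hx hx' =>
      (not_le.2 (mem_Ioi.1 hx)) (mem_Iic.1 (hp hx'))
    exact measure_mono_null hsub Measure.measure_compl_support
  rw [Measure.restrict_apply measurableSet_Ioi] at h1
  rw [ae_iff]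
  refine measure_mono_null (fun x hx => ?_) h1
  simp only [mem_ofPred_eq, Classical.not_imp] at hx
  exact ⟨hx.1, h0.trans hx.1.le, hx.2⟩

/-- The potential vanishes almost everywhere to the right of `γ`. -/
def VanishesBeyond (V : DiracPotential) (γ : ℝ) : Prop :=
  ∀ᵐ x, γ < x → V.p₁ x = 0 ∧ V.p₂ x = 0 ∧ V.q x = 0

theorem ConditionA.exists_vanishesBeyond (hV : V.ConditionA) :
    ∃ γ : ℝ, 0 < γ ∧ V.VanishesBeyond γ := by
  obtain ⟨γ, hγ, hlub⟩ := hV.exists_isLUB_supp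
  refine ⟨γ, hγ, ?_⟩
  filter_upwards [ae_eq_zero_of_essSupport_subset hγ.le
      (fun x hx => hlub.1 (Or.inl (Or.inl hx)) : essSupport V.p₁ ⊆ Iic γ),
    ae_eq_zero_of_essSupport_subset hγ.le
      (fun x hx => hlub.1 (Or.inl (Or.inr hx)) : essSupport V.p₂ ⊆ Iic γ),
    ae_eq_zero_of_essSupport_subset hγ.le
      (fun x hx => hlub.1 (Or.inr hx) : essSupport V.q ⊆ Iic γ)] with x h1 h2 h3 hx
  exact ⟨h1 hx, h2 hx, h3 hx⟩

theorem VanishesBeyond.ae_Ioc (h : V.VanishesBeyond γ) (hγ : γ ≤ a) (b : ℝ) :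
    ∀ᵐ x, x ∈ Ioc a b → V.p₁ x = 0 ∧ V.p₂ x = 0 ∧ V.q x = 0 := by
  filter_upwards [h] with x hx hxab using hx (hγ.trans_lt hxab.1)

theorem IsH1WithDeriv.isPrimitiveOn {f f' : ℝ → ℂ} (h : IsH1WithDeriv f f') (hb : 0 ≤ b) :
    IsPrimitiveOn f f' 0 b := by
  refine ⟨?_, fun x hx => h.eq_integral x hx.1⟩
  rw [intervalIntegrable_iff_integrableOn_Ioc_of_le hb]
  exact (h.memLp_deriv.mono_measure
    (Measure.restrict_mono Ioc_subset_Ioi_self le_rfl)).integrable (by norm_num)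

theorem IsResolvent.isSolOn (hu : IsResolvent m V z h u) (hb : 0 ≤ b) :
    IsSolOn m V z h u 0 b := by
  obtain ⟨f₁, f₂, h1, h2, -, hae⟩ := hu
  rw [ae_restrict_iff' measurableSet_Ioi] at hae
  refine ⟨(h1.isPrimitiveOn hb).congr (fun _ _ => rfl) ?_ hb,
    (h2.isPrimitiveOn hb).congr (fun _ _ => rfl) ?_ hb⟩
  · filter_upwards [hae] with x hx hxb
    have := (hx hxb.1).2
    simp only [Prod.snd_add, Prod.smul_snd, smul_eq_mul] at this
    linear_combination this
  · filter_upwards [hae] with x hx hxb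
    have := (hx hxb.1).1
    simp only [Prod.fst_add, Prod.smul_fst, smul_eq_mul] at this
    linear_combination -this

theorem not_memLp_of_norm_ge {f : ℝ → ℂ} (hf : MemLp f 2 halfLine) {c : ℝ} (hR : 0 ≤ R)
    (h : ∀ x, R ≤ x → c ≤ ‖f x‖) : c ≤ 0 := by
  by_contra! hc
  have h1 : MemLp f 2 (volume.restrict (Ioi R)) :=
    hf.mono_measure (Measure.restrict_mono (Ioi_subset_Ioi hR) le_rfl)
  have h2 : MemLp (fun _ : ℝ => c) 2 (volume.restrict (Ioi R)) := by
    refine h1.mono aestronglyMeasurable_const ?_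
    filter_upwards [ae_restrict_mem measurableSet_Ioi] with x hx
    rw [Real.norm_of_nonneg hc.le]
    exact h x (le_of_lt hx)
  rw [memLp_const_iff (by norm_num) (by norm_num)] at h2
  rcases h2 with h2 | h2
  · exact hc.ne' h2
  · simp at h2

/-- Beyond `R` the form `u₂ - τ u₁` is multiplied by a factor of modulus at least one, so it can be
square integrable only if it vanishes. -/
theorem IsResolvent.boundary_form_eq_zero (hu : IsResolvent m V z h u)
    (hV0 : V.VanishesBeyond γ) (hγR : γ ≤ R) (hR : 0 ≤ R) (hh : ∀ x, R < x → h x = 0)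
    (hτ : τ ^ 2 * (z + m) = m - z) (hre : (τ * (z + m)).re < 0) :
    (u R).2 - τ * (u R).1 = 0 := by
  have hmem : MemLp (fun x => (u x).2 - τ * (u x).1) 2 halfLine := by
    obtain ⟨f₁, f₂, h1, h2, -⟩ := hu
    exact h2.memLp.sub (h1.memLp.const_mul τ)
  have hc := not_memLp_of_norm_ge hmem (c := ‖(u R).2 - τ * (u R).1‖) hR fun x hx => by
    have hs := (hu.isSolOn (hR.trans hx)).mono hR hx le_rfl
    rw [hs.boundary_form hx (hV0.ae_Ioc hγR x) (fun t ht => hh t ht.1) hτ, norm_mul,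
      Complex.norm_exp]
    refine le_mul_of_one_le_left (norm_nonneg _) (Real.one_le_exp ?_)
    have : (-(τ * (z + m) * (x - R))).re = -(τ * (z + m)).re * (x - R) := by
      rw [← Complex.ofReal_sub, Complex.neg_re, Complex.re_mul_ofReal, neg_mul]
    rw [this]
    exact mul_nonneg (neg_nonneg.2 hre.le) (sub_nonneg.2 hx)
  exact norm_le_zero_iff.1 hc

theorem IsTest.integrableOn (hh : IsTest h) (R : ℝ) : IntegrableOn h (Ioc 0 R) :=
  ((hh.continuousOn.mono Icc_subset_Ici_self).integrableOn_Icc).mono_set Ioc_subset_Icc_self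

/-- The pairing with `h` over `(0, R]`, as a functional on bounded continuous functions. -/
theorem exists_pairing (hR : 0 ≤ R) (hg : IntegrableOn g (Ioc 0 R)) :
    ∃ L : (ℝ →ᵇ ℂ × ℂ) →L[ℂ] ℂ, ∀ f : ℝ →ᵇ ℂ × ℂ,
      L f = ∫ t in (0 : ℝ)..R, ((f t).1 * (g t).1 + (f t).2 * (g t).2) := by
  let A : ℝ → (ℂ × ℂ) →L[ℂ] ℂ := fun t =>
    (Ioc 0 R).indicator (fun t => (g t).1) t • ContinuousLinearMap.fst ℂ ℂ ℂ +
      (Ioc 0 R).indicator (fun t => (g t).2) t • ContinuousLinearMap.snd ℂ ℂ ℂ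
  have hA : Integrable A := by
    have h1 : IntegrableOn (fun t => (g t).1) (Ioc 0 R) := hg.fst
    have h2 : IntegrableOn (fun t => (g t).2) (Ioc 0 R) := hg.snd
    have k1 := (h1.integrable_indicator measurableSet_Ioc).smul_const
      (ContinuousLinearMap.fst ℂ ℂ ℂ)
    have k2 := (h2.integrable_indicator measurableSet_Ioc).smul_const
      (ContinuousLinearMap.snd ℂ ℂ ℂ)
    exact k1.add k2
  refine ⟨BoundedContinuousFunction.evalCLM ℂ R ∘L volterra A hA, fun f => ?_⟩
  simp only [ContinuousLinearMap.comp_apply, BoundedContinuousFunction.evalCLM_apply,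
    volterra_apply]
  refine intervalIntegral.integral_congr_ae (Eventually.of_forall fun t ht => ?_)
  rw [uIoc_of_le hR] at ht
  simp only [A, indicator_of_mem ht]
  simp [mul_comm]

/-- The inner product only sees the support of `h`. -/
theorem innerL2_eq (hR : 0 ≤ R) (hh : ∀ x, R < x → h x = 0) (u : ℝ → ℂ × ℂ) :
    innerL2 u h =
      ∫ x in (0 : ℝ)..R, ((u x).1 * (star (h x)).1 + (u x).2 * (star (h x)).2) := by
  rw [innerL2, intervalIntegral.integral_of_le hR]
  refine (setIntegral_eq_of_subset_of_forall_sdiff_eq_zero measurableSet_Ioi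
    Ioc_subset_Ioi_self fun x hx => ?_)
  have : h x = 0 := hh x (not_le.1 fun hle => hx.2 ⟨hx.1, hle⟩)
  simp [this]

end DiracPotential

namespace DiracPotential

variable {m : ℝ} {V : DiracPotential} {z τ : ℂ} {g y w h u : ℝ → ℂ × ℂ} {a b c R γ : ℝ}

theorem memLp_two_of_norm_le_exp {f : ℝ → ℂ} {C δ : ℝ} (hf : Continuous f) (hδ : 0 < δ)
    (hle : ∀ x, 0 ≤ x → ‖f x‖ ≤ C * Real.exp (-δ * x)) : MemLp f 2 halfLine := by
  have hexp : MemLp (fun x : ℝ => C * Real.exp (-δ * x)) 2 halfLine := by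
    rw [memLp_two_iff_integrable_sq (by fun_prop)]
    have : IntegrableOn (fun x : ℝ => C ^ 2 * Real.exp (-(2 * δ) * x)) (Ioi 0) :=
      (integrableOn_exp_mul_Ioi (by linarith) 0).const_mul _
    refine this.congr_fun (fun x _ => ?_) measurableSet_Ioi
    simp only [mul_pow, ← Real.exp_nat_mul]
    congr 2
    push_cast
    ring
  refine hexp.mono hf.aestronglyMeasurable ?_
  filter_upwards [ae_restrict_mem measurableSet_Ioi] with x hx
  exact (hle x (le_of_lt hx)).trans (le_abs_self _)

theorem IsTest.memLp (hh : IsTest h) (hR : ∀ x, R < x → h x = 0) : MemLp h 2 halfLine := by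
  obtain ⟨C, hC⟩ := isCompact_Icc.exists_bound_of_continuousOn
    (hh.continuousOn.mono (Icc_subset_Ici_self : Icc 0 R ⊆ Ici 0))
  have h1 : MemLp h 2 (volume.restrict (Ioc 0 R)) := by
    refine MemLp.of_bound (hh.integrableOn R).aestronglyMeasurable C ?_
    filter_upwards [ae_restrict_mem measurableSet_Ioc] with x hx
    exact hC x (Ioc_subset_Icc_self hx)
  have h2 : MemLp ((Ioc 0 R).indicator h) 2 volume :=
    (memLp_indicator_iff_restrict measurableSet_Ioc).2 h1
  refine (h2.restrict (Ioi 0)).ae_eq ?_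
  filter_upwards [ae_restrict_mem measurableSet_Ioi] with x hx
  by_cases hxR : x ≤ R
  · rw [indicator_of_mem (show x ∈ Ioc 0 R from ⟨hx, hxR⟩)]
  · rw [indicator_of_notMem (fun h => hxR h.2), hR x (not_le.1 hxR)]

theorem ConditionA.memLp_mul {u : ℝ → ℂ} (hu : MemLp u ⊤ halfLine) {p : ℝ → ℝ}
    (hp : MemLp p 2 halfLine) : MemLp (fun x => (p x : ℂ) * u x) 2 halfLine := by
  have := (hp.ofReal (K := ℂ)).mul' (r := 2) hu
  exact this.ae_eq (Eventually.of_forall fun x => mul_comm _ _)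

/-- The right-hand sides of the system are square integrable because a potential in `L²` times a
bounded function is in `L²`. -/
theorem ConditionA.memLp_system (hV : V.ConditionA)
    (hu1 : MemLp (fun x => (u x).1) 2 halfLine) (hu2 : MemLp (fun x => (u x).2) 2 halfLine)
    (hu1' : MemLp (fun x => (u x).1) ⊤ halfLine) (hu2' : MemLp (fun x => (u x).2) ⊤ halfLine)
    (hh : MemLp h 2 halfLine) :
    MemLp (fun x => -(V.q x : ℂ) * (u x).1 + (z + m - V.p₂ x) * (u x).2 + (h x).2) 2 halfLine ∧
    MemLp (fun x => ((m : ℂ) + V.p₁ x - z) * (u x).1 + (V.q x : ℂ) * (u x).2 - (h x).1)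
      2 halfLine := by
  have a1 := ConditionA.memLp_mul hu1' hV.memLp_q
  have a2 := ConditionA.memLp_mul hu2' hV.memLp_p₂
  have a3 := ConditionA.memLp_mul hu1' hV.memLp_p₁
  have a4 := ConditionA.memLp_mul hu2' hV.memLp_q
  have b1 := (a1.neg.add ((hu2.const_mul (z + m)).sub a2)).add hh.snd
  have b2 := (((hu1.const_mul (m - z)).add a3).add a4).sub hh.fst
  refine ⟨b1.ae_eq (Eventually.of_forall fun x => ?_),
    b2.ae_eq (Eventually.of_forall fun x => ?_)⟩
  · simp only [Pi.add_apply, Pi.sub_apply, Pi.neg_apply]; ring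
  · simp only [Pi.add_apply, Pi.sub_apply]; ring

/-- The condition `W₂ = τ W₁` at `R` lets the solution be prolonged by the decaying free
exponential. -/
theorem exists_isResolvent (hV : V.ConditionA) (hV0 : V.VanishesBeyond γ) (hγR : γ ≤ R)
    (hR : 0 ≤ R) (hh : IsTest h) (hhR : ∀ x, R < x → h x = 0)
    (hτ : τ ^ 2 * (z + m) = m - z) (hre : (τ * (z + m)).re < 0) {W : ℝ →ᵇ ℂ × ℂ}
    (hW : IsSolOn m V z h W 0 R) (hW0 : (W 0).1 = 0) (hWR : ∀ x, R ≤ x → W x = W R)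
    (hB : (W R).2 = τ * (W R).1) :
    ∃ u, IsResolvent m V z h u ∧ ∀ x ∈ Icc 0 R, u x = W x := by
  set μ := τ * (z + m) with hμ
  -- This factor is 1 up to `R`, and `W` is constant afterwards, so `e • W` is the glued function in
  -- one formula.
  let e : ℝ → ℂ := fun x => Complex.exp (μ * ((max x R - R : ℝ) : ℂ))
  have hec : Continuous e := by fun_prop
  let u : ℝ → ℂ × ℂ := fun x => e x • W x
  have huc : Continuous u := hec.smul W.continuous
  have heq : ∀ x ∈ Icc 0 R, u x = W x := fun x hx => by simp [u, e, max_eq_right hx.2]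
  have htail : ∀ x, R ≤ x → u x = Complex.exp (μ * ((x - R : ℝ) : ℂ)) • W R := fun x hx => by
    simp only [u, e, max_eq_left hx, hWR x hx]
  have hsol : ∀ b, R ≤ b → IsSolOn m V z h u 0 b := by
    intro b hb
    refine (hW.congr hR heq).trans ?_ hR
    have hprim : ∀ v : ℂ, IsPrimitiveOn (fun x : ℝ => Complex.exp (μ * ((x - R : ℝ) : ℂ)) * v)
        (fun x : ℝ => μ * Complex.exp (μ * ((x - R : ℝ) : ℂ)) * v) R b := by
      intro v
      have hd : ∀ x : ℝ, HasDerivAt (fun x : ℝ => Complex.exp (μ * ((x - R : ℝ) : ℂ)) * v)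
          (μ * Complex.exp (μ * ((x - R : ℝ) : ℂ)) * v) x := fun x => by
        have h1 : HasDerivAt (fun x : ℝ => x - R) 1 x := (hasDerivAt_id x).sub_const R
        have := ((h1.ofReal_comp.const_mul μ).cexp).mul_const v
        simpa [mul_comm] using this
      have hc : Continuous fun x : ℝ => μ * Complex.exp (μ * ((x - R : ℝ) : ℂ)) * v := by
        fun_prop
      refine ⟨hc.intervalIntegrable _ _, fun x _ => ?_⟩
      rw [intervalIntegral.integral_eq_sub_of_hasDerivAt (fun t _ => hd t)
        (hc.intervalIntegrable _ _)]
      ring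
    have hz : ∀ᵐ x, x ∈ Ioc R b → V.p₁ x = 0 ∧ V.p₂ x = 0 ∧ V.q x = 0 := hV0.ae_Ioc hγR b
    refine ⟨(hprim (W R).1).congr (fun x hx => by rw [htail x hx.1]; rfl) ?_ hb,
      (hprim (W R).2).congr (fun x hx => by rw [htail x hx.1]; rfl) ?_ hb⟩
    · filter_upwards [hz] with x hx hxb
      obtain ⟨h1, h2, h3⟩ := hx hxb
      rw [htail x hxb.1.le]
      simp only [h2, h3, hhR x hxb.1, Prod.smul_fst, Prod.smul_snd, smul_eq_mul, hB, hμ,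
        Complex.ofReal_zero, Prod.snd_zero]
      ring
    · filter_upwards [hz] with x hx hxb
      obtain ⟨h1, h2, h3⟩ := hx hxb
      rw [htail x hxb.1.le]
      simp only [h1, h3, hhR x hxb.1, Prod.smul_fst, Prod.smul_snd, smul_eq_mul, hB, hμ,
        Complex.ofReal_zero, Prod.fst_zero]
      linear_combination
        (-Complex.exp (τ * (z + m) * ((x - R : ℝ) : ℂ)) * (W R).1) * hτ
  have hnorm : ∀ x, 0 ≤ x → ‖u x‖ ≤ ‖W‖ * Real.exp (-μ.re * R) * Real.exp (-(-μ.re) * x) := by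
    intro x _
    have h1 : ‖e x‖ ≤ Real.exp (-μ.re * R) * Real.exp (-(-μ.re) * x) := by
      rw [Complex.norm_exp, ← Real.exp_add, Complex.re_mul_ofReal]
      refine Real.exp_le_exp.2 ?_
      nlinarith [le_max_left x R]
    calc ‖u x‖ = ‖e x‖ * ‖W x‖ := norm_smul _ _
      _ ≤ (Real.exp (-μ.re * R) * Real.exp (-(-μ.re) * x)) * ‖W‖ :=
        mul_le_mul h1 (W.norm_coe_le_norm x) (norm_nonneg _) (by positivity)
      _ = _ := by ring
  have hδ : 0 < -μ.re := by linarith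
  have hu1 : MemLp (fun x => (u x).1) 2 halfLine :=
    memLp_two_of_norm_le_exp huc.fst hδ fun x hx => (norm_fst_le _).trans (hnorm x hx)
  have hu2 : MemLp (fun x => (u x).2) 2 halfLine :=
    memLp_two_of_norm_le_exp huc.snd hδ fun x hx => (norm_snd_le _).trans (hnorm x hx)
  have hbdd : ∀ x, 0 ≤ x → ‖u x‖ ≤ ‖W‖ * Real.exp (-μ.re * R) := fun x hx =>
    (hnorm x hx).trans (mul_le_of_le_one_right (by positivity)
      (Real.exp_le_one_iff.2 (by nlinarith)))
  have hu1' : MemLp (fun x => (u x).1) ⊤ halfLine := by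
    refine memLp_top_of_bound huc.fst.aestronglyMeasurable (‖W‖ * Real.exp (-μ.re * R)) ?_
    filter_upwards [ae_restrict_mem measurableSet_Ioi] with x hx
    exact (norm_fst_le _).trans (hbdd x (le_of_lt hx))
  have hu2' : MemLp (fun x => (u x).2) ⊤ halfLine := by
    refine memLp_top_of_bound huc.snd.aestronglyMeasurable (‖W‖ * Real.exp (-μ.re * R)) ?_
    filter_upwards [ae_restrict_mem measurableSet_Ioi] with x hx
    exact (norm_snd_le _).trans (hbdd x (le_of_lt hx))
  obtain ⟨hd1, hd2⟩ := hV.memLp_system (m := m) (z := z) hu1 hu2 hu1' hu2' (hh.memLp hhR)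
  refine ⟨u, ⟨_, _, ⟨hu1, hd1, fun x hx => ?_⟩, ⟨hu2, hd2, fun x hx => ?_⟩, ?_, ?_⟩, heq⟩
  · exact (hsol (max R x) (le_max_left _ _)).fst.eq_integral x ⟨hx, le_max_right _ _⟩
  · exact (hsol (max R x) (le_max_left _ _)).snd.eq_integral x ⟨hx, le_max_right _ _⟩
  · rw [heq 0 ⟨le_rfl, hR⟩, hW0]
  · refine Eventually.of_forall fun x => ⟨?_, ?_⟩
    · simp only [Prod.fst_add, Prod.smul_fst, smul_eq_mul]; ring
    · simp only [Prod.snd_add, Prod.smul_snd, smul_eq_mul]; ring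

end DiracPotential

/-! ### The regular solution, the Jost function and the resolvent formula. -/

namespace DiracPotential

variable {m : ℝ} {V : DiracPotential} {z τ : ℂ} {g y w h u : ℝ → ℂ × ℂ} {a b c R γ : ℝ}

/-- The solution of `(H - z) φ = 0` on `[0, R]` with `φ(0) = (0, 1)`. -/
def regularSolution (hV : V.ConditionA) (m : ℝ) (hR : 0 ≤ R) : ℂ → (ℝ →ᵇ ℂ × ℂ) :=
  (exists_analytic_solution (m := m) (g := 0) hV hR integrableOn_zero (0, 1)).choose

theorem differentiable_regularSolution (hV : V.ConditionA) (m : ℝ) (hR : 0 ≤ R) :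
    Differentiable ℂ (regularSolution hV m hR) :=
  (exists_analytic_solution (m := m) (g := 0) hV hR integrableOn_zero (0, 1)).choose_spec.1

theorem isSolOn_regularSolution (hV : V.ConditionA) (m : ℝ) (hR : 0 ≤ R) (z : ℂ) :
    IsSolOn m V z 0 (regularSolution hV m hR z) 0 R :=
  ((exists_analytic_solution (m := m) (g := 0) hV hR
    integrableOn_zero (0, 1)).choose_spec.2 z).1

theorem regularSolution_zero (hV : V.ConditionA) (m : ℝ) (hR : 0 ≤ R) (z : ℂ) :
    regularSolution hV m hR z 0 = (0, 1) :=
  ((exists_analytic_solution (m := m) (g := 0) hV hR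
    integrableOn_zero (0, 1)).choose_spec.2 z).2.1

theorem regularSolution_of_le (hV : V.ConditionA) (m : ℝ) (hR : 0 ≤ R) (z : ℂ) {x : ℝ}
    (hx : R ≤ x) : regularSolution hV m hR z x = regularSolution hV m hR z R :=
  ((exists_analytic_solution (m := m) (g := 0) hV hR
    integrableOn_zero (0, 1)).choose_spec.2 z).2.2 x hx

theorem regularSolution_eq (hV : V.ConditionA) (m : ℝ) (hγ : 0 ≤ γ) (hγR : γ ≤ R) (z : ℂ) :
    ∀ x ∈ Icc 0 γ, regularSolution hV m (hγ.trans hγR) z x = regularSolution hV m hγ z x :=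
  ((isSolOn_regularSolution hV m (hγ.trans hγR) z).mono le_rfl hγ hγR).eq_of_eq_zero hV hγ
    (isSolOn_regularSolution hV m hγ z) (by rw [regularSolution_zero, regularSolution_zero])

theorem regularSolution_conj (hV : V.ConditionA) (m : ℝ) (hR : 0 ≤ R) (z : ℂ) :
    ∀ x ∈ Icc 0 R, regularSolution hV m hR (star z) x = star (regularSolution hV m hR z x) := by
  have h1 := (isSolOn_regularSolution hV m hR z).conj hR
  simp only [Pi.zero_apply, star_zero] at h1
  refine (isSolOn_regularSolution hV m hR (star z)).eq_of_eq_zero hV hR h1 ?_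
  rw [regularSolution_zero, regularSolution_zero]
  simp [Prod.ext_iff]

theorem regularSolution_ne_zero (hV : V.ConditionA) (m : ℝ) (hR : 0 ≤ R) (z : ℂ) {x : ℝ}
    (hx : x ∈ Icc 0 R) : regularSolution hV m hR z x ≠ 0 :=
  ((isSolOn_regularSolution hV m hR z).mono le_rfl hx.1 hx.2).ne_zero hV hx.1
    (regularSolution_zero hV m hR z)

theorem integral_normSq_regularSolution_pos (hV : V.ConditionA) (m : ℝ) (hR : 0 < R) (z : ℂ)
    {χ : ℝ → ℝ} (hχ : Continuous χ) (hχ0 : ∀ x ∈ Ioo 0 R, 0 < χ x) :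
    0 < ∫ x in (0 : ℝ)..R, (Complex.normSq (regularSolution hV m hR.le z x).1 +
      Complex.normSq (regularSolution hV m hR.le z x).2) * χ x := by
  have hc := (regularSolution hV m hR.le z).continuous
  refine intervalIntegral.intervalIntegral_pos_of_pos_on ?_ (fun x hx => ?_) hR
  · exact (((Complex.continuous_normSq.comp hc.fst).add
      (Complex.continuous_normSq.comp hc.snd)).mul hχ).intervalIntegrable _ _
  · have := regularSolution_ne_zero hV m hR.le z (Ioo_subset_Icc_self hx)
    refine mul_pos ?_ (hχ0 x hx)
    by_contra! hle
    have h1 := Complex.normSq_nonneg (regularSolution hV m hR.le z x).1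
    have h2 := Complex.normSq_nonneg (regularSolution hV m hR.le z x).2
    exact this (Prod.ext (Complex.normSq_eq_zero.1 (by linarith))
      (Complex.normSq_eq_zero.1 (by linarith)))

/-- The functions `(y₁, y₂) ↦ y₂ - τ y₁` of the regular solution at `γ`; with `τ = i k / (z + m)`
this is the Jost function. -/
def jostForm (hV : V.ConditionA) (m : ℝ) (hγ : 0 ≤ γ) (τ z : ℂ) : ℂ :=
  (regularSolution hV m hγ z γ).2 - τ * (regularSolution hV m hγ z γ).1

/-- If `y₂ = τ y₁` at `γ`, Lagrange's identity for `y` and its conjugate gives `-Im τ |y₁(γ)|² = Im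
z ∫ |y|²`, with sides of incompatible signs. -/
theorem jostForm_ne_zero (hV : V.ConditionA) (m : ℝ) (hγ : 0 < γ) (hz : 0 < z.im)
    (hτ : 0 < τ.im) : jostForm hV m hγ.le τ z ≠ 0 := by
  intro hD
  have hs := isSolOn_regularSolution hV m hγ.le z
  set y := regularSolution hV m hγ.le z with hy
  have hp := (hs.lagrange (hs.conj hγ.le) hγ.le).eq_integral γ ⟨hγ.le, le_rfl⟩
  have hpos := integral_normSq_regularSolution_pos hV m hγ z (continuous_const (y := (1 : ℝ)))
    fun _ _ => one_pos
  simp only [mul_one, ← hy] at hpos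
  have h0 : wronskian y (fun x => star (y x)) 0 = 0 := by
    simp [wronskian, hy, regularSolution_zero]
  have hγ' : wronskian y (fun x => star (y x)) γ =
      -(2 * Complex.I * τ.im) * Complex.normSq (y γ).1 := by
    have h2 : (y γ).2 = τ * (y γ).1 := sub_eq_zero.1 hD
    simp only [wronskian, Prod.fst_star, Prod.snd_star, h2, star_mul']
    have h3 : τ - star τ = 2 * Complex.I * τ.im := by
      have := Complex.sub_conj τ
      simp only [Complex.star_def, this]; push_cast; ring
    have h4 : (y γ).1 * star (y γ).1 = Complex.normSq (y γ).1 := Complex.mul_conj _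
    linear_combination (-(y γ).1 * star (y γ).1) * h3 - 2 * Complex.I * τ.im * h4
  have hint : ∫ t in (0 : ℝ)..γ, ((z - star z) * ((y t).1 * (star (y t)).1 +
      (y t).2 * (star (y t)).2) + (((0 : ℝ → ℂ × ℂ) t).1 * (star (y t)).1 +
      ((0 : ℝ → ℂ × ℂ) t).2 * (star (y t)).2) - ((y t).1 * (star ((0 : ℝ → ℂ × ℂ) t)).1 +
      (y t).2 * (star ((0 : ℝ → ℂ × ℂ) t)).2)) =
      2 * Complex.I * z.im * ((∫ x in (0 : ℝ)..γ, (Complex.normSq (y x).1 +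
        Complex.normSq (y x).2) : ℝ) : ℂ) := by
    rw [← intervalIntegral.integral_ofReal, ← intervalIntegral.integral_const_mul]
    refine intervalIntegral.integral_congr fun t _ => ?_
    have h3 : z - star z = 2 * Complex.I * z.im := by
      have := Complex.sub_conj z
      simp only [Complex.star_def, this]; push_cast; ring
    have h4 : (y t).1 * star (y t).1 = Complex.normSq (y t).1 := Complex.mul_conj _
    have h5 : (y t).2 * star (y t).2 = Complex.normSq (y t).2 := Complex.mul_conj _
    simp only [h3, Prod.fst_star, Prod.snd_star, h4, h5, Pi.zero_apply, Prod.fst_zero,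
      Prod.snd_zero, star_zero]
    push_cast
    ring
  rw [h0, hγ', zero_add] at hp
  have hp' := hp.trans hint
  have h6 : -τ.im * Complex.normSq (y γ).1 = z.im * ∫ x in (0 : ℝ)..γ,
      (Complex.normSq (y x).1 + Complex.normSq (y x).2) := by
    have hI : (2 * Complex.I : ℂ) ≠ 0 := by simp
    apply Complex.ofReal_injective
    refine mul_left_cancel₀ hI ?_
    push_cast at hp' ⊢
    linear_combination hp'
  have h7 := mul_pos hz hpos
  rw [← h6] at h7
  nlinarith [Complex.normSq_nonneg (y γ).1, mul_nonneg hτ.le (Complex.normSq_nonneg (y γ).1)]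

/-- The shape of `z ↦ ((H - z)⁻¹ h, h)` in terms of `τ`, the value `τ = i k / (z + m)` being
determined up to sign by `z`. -/
def greenFormula (m ρ : ℝ) (E N₁ N₂ C : ℂ → ℂ) (D : ℂ → ℂ → ℂ) (τ z : ℂ) : ℂ :=
  E z - Complex.exp (τ * (z + m) * ρ) * (N₂ z - τ * N₁ z) * C z / D τ z

/-- The resolvent is `Y + c φ` on `[0, R]`, where `Y` is the particular solution with `Y(0) = 0` and
`c` is fixed by the boundary condition at `R`. The functions `E`, `C` pair `Y`, `φ` with `h`, and
`N₁`, `N₂` are the components of `Y(R)`. The last two clauses serve to show that the numerator is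
nonzero at a zero of the Jost function for a suitable `h`. -/
theorem exists_greenFormula (hV : V.ConditionA) (hV0 : V.VanishesBeyond γ) (hγ : 0 < γ)
    (hγR : γ ≤ R) (hh : IsTest h) (hhR : ∀ x, R < x → h x = 0) :
    ∃ E N₁ N₂ C : ℂ → ℂ, (Differentiable ℂ E ∧ Differentiable ℂ N₁ ∧ Differentiable ℂ N₂ ∧
        Differentiable ℂ C) ∧
      (∀ z τ : ℂ, τ ^ 2 * (z + m) = m - z → (τ * (z + m)).re < 0 →
        jostForm hV m hγ.le τ z ≠ 0 → (∃ u, IsResolvent m V z h u) ∧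
        ∀ u, IsResolvent m V z h u → innerL2 u h =
          greenFormula m (R - γ) E N₁ N₂ C (jostForm hV m hγ.le) τ z) ∧
      (∀ z, C z = ∫ x in (0 : ℝ)..R,
        ((regularSolution hV m (hγ.le.trans hγR) z x).1 * (star (h x)).1 +
          (regularSolution hV m (hγ.le.trans hγR) z x).2 * (star (h x)).2)) ∧
      (∀ z τ : ℂ, τ ^ 2 * (z + m) = m - z → jostForm hV m hγ.le τ z = 0 →
        ∃ κ : ℂ, κ * (N₂ z - τ * N₁ z) = -∫ x in (0 : ℝ)..R,
          ((regularSolution hV m (hγ.le.trans hγR) z x).1 * (h x).1 +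
            (regularSolution hV m (hγ.le.trans hγR) z x).2 * (h x).2)) := by
  have hR : 0 ≤ R := hγ.le.trans hγR
  obtain ⟨Y, hYd, hY⟩ := exists_analytic_solution (m := m) hV hR (hh.integrableOn R) 0
  have hstar : IntegrableOn (fun x => star (h x)) (Ioc 0 R) := by
    have := ((starL' ℝ (A := ℂ × ℂ)) : (ℂ × ℂ) →L[ℝ] (ℂ × ℂ)).integrable_comp (hh.integrableOn R)
    exact this
  obtain ⟨L, hL⟩ := exists_pairing hR hstar
  set Φ := regularSolution hV m hR with hΦ
  have hΦd : Differentiable ℂ Φ := differentiable_regularSolution hV m hR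
  have hΦs := isSolOn_regularSolution hV m hR
  have heval : Differentiable ℂ fun z => Y z R :=
    fun z => (BoundedContinuousFunction.evalCLM ℂ (β := ℂ × ℂ) R).differentiableAt.comp z (hYd z)
  -- Moving the boundary form from `R` back to `γ` makes the denominator independent of `h`.
  have hform : ∀ z τ : ℂ, τ ^ 2 * (z + m) = m - z → (Φ z R).2 - τ * (Φ z R).1 =
      Complex.exp (-(τ * (z + m) * (R - γ))) * jostForm hV m hγ.le τ z := by
    intro z τ hτ
    have := ((hΦs z).mono hγ.le hγR le_rfl).boundary_form hγR (hV0.ae_Ioc le_rfl R)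
      (fun x _ => rfl) hτ
    rw [this, ← hΦ, hΦ, regularSolution_eq hV m hγ.le hγR z γ ⟨hγ.le, le_rfl⟩, jostForm]
  refine ⟨fun z => L (Y z), fun z => (Y z R).1, fun z => (Y z R).2, fun z => L (Φ z),
    ⟨L.differentiable.comp hYd, heval.fst, heval.snd, L.differentiable.comp hΦd⟩, ?_,
    fun z => hL _, ?_⟩
  · intro z τ hτ hre hD
    have hΦR : (Φ z R).2 - τ * (Φ z R).1 ≠ 0 := by
      rw [hform z τ hτ]
      exact mul_ne_zero (Complex.exp_ne_zero _) hD
    constructor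
    · set c : ℂ := -((Y z R).2 - τ * (Y z R).1) / ((Φ z R).2 - τ * (Φ z R).1) with hc
      have hW : IsSolOn m V z h (Y z + c • Φ z : ℝ →ᵇ ℂ × ℂ) 0 R :=
        (hY z).1.add_smul (hΦs z) hR c
      obtain ⟨u, hu, -⟩ := exists_isResolvent hV hV0 hγR hR hh hhR hτ hre hW
        (by simp [(hY z).2.1, hΦ, regularSolution_zero])
        (fun x hx => by
          simp only [BoundedContinuousFunction.coe_add, BoundedContinuousFunction.coe_smul,
            Pi.add_apply]
          rw [(hY z).2.2 x hx, hΦ, regularSolution_of_le hV m hR z hx])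
        (by
          simp only [BoundedContinuousFunction.coe_add, BoundedContinuousFunction.coe_smul,
            Pi.add_apply, Prod.fst_add, Prod.snd_add, Prod.smul_fst, Prod.smul_snd, smul_eq_mul]
          have : c * ((Φ z R).2 - τ * (Φ z R).1) = -((Y z R).2 - τ * (Y z R).1) :=
            div_mul_cancel₀ _ hΦR
          linear_combination this)
      exact ⟨u, hu⟩
    · intro u hu
      set c : ℂ := (u 0).2 with hc
      have hu1 : (u 0).1 = 0 := by
        obtain ⟨_, _, _, _, h0, _⟩ := hu
        exact h0
      have heq : ∀ x ∈ Icc 0 R, u x = Y z x + c • Φ z x :=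
        (hu.isSolOn hR).eq_of_eq_zero hV hR ((hY z).1.add_smul (hΦs z) hR c) (by
          rw [(hY z).2.1, hΦ, regularSolution_zero]
          ext <;> simp [hu1, hc])
      have hb := hu.boundary_form_eq_zero hV0 hγR hR hhR hτ hre
      rw [heq R ⟨hR, le_rfl⟩] at hb
      simp only [Prod.fst_add, Prod.snd_add, Prod.smul_fst, Prod.smul_snd, smul_eq_mul] at hb
      have hcD : c * (Complex.exp (-(τ * (z + m) * (R - γ))) * jostForm hV m hγ.le τ z) =
          -((Y z R).2 - τ * (Y z R).1) := by
        rw [← hform z τ hτ]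
        linear_combination hb
      have hcv : c = -(Complex.exp (τ * (z + m) * ((R - γ : ℝ) : ℂ)) *
          ((Y z R).2 - τ * (Y z R).1)) / jostForm hV m hγ.le τ z := by
        rw [eq_div_iff hD]
        have hee : Complex.exp (τ * (z + m) * ((R - γ : ℝ) : ℂ)) *
            Complex.exp (-(τ * (z + m) * (R - γ))) = 1 := by
          rw [← Complex.exp_add, Complex.ofReal_sub, add_neg_cancel, Complex.exp_zero]
        linear_combination Complex.exp (τ * (z + m) * ((R - γ : ℝ) : ℂ)) * hcD -
          c * jostForm hV m hγ.le τ z * hee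
      have hin : innerL2 u h = L (Y z + c • Φ z) := by
        rw [innerL2_eq hR hhR, hL]
        refine intervalIntegral.integral_congr fun x hx => ?_
        rw [uIcc_of_le hR] at hx
        simp only [heq x hx, BoundedContinuousFunction.coe_add, BoundedContinuousFunction.coe_smul,
          Pi.add_apply]
      rw [hin, map_add, map_smul, smul_eq_mul, greenFormula, hcv]
      ring
  · intro z τ hτ hD
    -- At a zero of the Jost function `φ₂ = τ φ₁` at `R`, so the Wronskian of `φ` and `Y` there is
    -- `φ₁ (Y₂ - τ Y₁)`; Lagrange's identity evaluates it.
    refine ⟨(Φ z R).1, ?_⟩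
    have h2 : (Φ z R).2 = τ * (Φ z R).1 := by
      have := hform z τ hτ
      rw [hD, mul_zero] at this
      exact sub_eq_zero.1 this
    have hp := ((hΦs z).lagrange (hY z).1 hR).eq_integral R ⟨hR, le_rfl⟩
    have h0 : wronskian (regularSolution hV m hR z) (Y z) 0 = 0 := by
      simp [wronskian, regularSolution_zero, (hY z).2.1]
    rw [h0, zero_add, wronskian, ← hΦ, h2] at hp
    rw [← intervalIntegral.integral_neg]
    refine Eq.trans ?_ (hp.trans (intervalIntegral.integral_congr fun x _ => ?_))
    · ring
    · simp

end DiracPotential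

/-! ### Square roots and pole orders of `E - Q / D`. -/

/-- The principal branch of the square root. -/
def principalSqrt (w : ℂ) : ℂ := w ^ ((2 : ℂ)⁻¹)

theorem principalSqrt_sq (w : ℂ) : principalSqrt w ^ 2 = w := by
  exact Complex.cpow_nat_inv_pow w (n := 2) two_ne_zero

theorem principalSqrt_re_pos {w : ℂ} (hw : w ∈ Complex.slitPlane) : 0 < (principalSqrt w).re := by
  have h0 := Complex.slitPlane_ne_zero hw
  have h1 : |Complex.arg w| < Real.pi := lt_of_le_of_ne (Complex.abs_arg_le_pi w) fun h => by
    rcases (abs_eq Real.pi_pos.le).1 h with h | h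
    · exact (Complex.mem_slitPlane_iff_arg.1 hw).1 h
    · exact absurd h (Complex.neg_pi_lt_arg w).ne'
  rw [abs_lt] at h1
  rw [principalSqrt, Complex.cpow_def_of_ne_zero h0, Complex.exp_re]
  refine mul_pos (Real.exp_pos _) (Real.cos_pos_of_mem_Ioo ?_)
  have h2 : (Complex.log w * (2 : ℂ)⁻¹).im = Complex.arg w / 2 := by
    rw [show (2 : ℂ)⁻¹ = ((2⁻¹ : ℝ) : ℂ) by push_cast; rfl, Complex.im_mul_ofReal, Complex.log_im]
    ring
  rw [h2]
  constructor <;> linarith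

theorem analyticAt_principalSqrt {w : ℂ} (hw : w ∈ Complex.slitPlane) :
    AnalyticAt ℂ principalSqrt w :=
  analyticAt_id.cpow analyticAt_const hw

theorem meromorphicOrderAt_sub_div_of_neg {E Q D : ℂ → ℂ} {x : ℂ} (hE : AnalyticAt ℂ E x)
    (hQ : AnalyticAt ℂ Q x) (hD : AnalyticAt ℂ D x) {n : ℕ} (hn : 0 < n)
    (h : meromorphicOrderAt (fun z => E z - Q z / D z) x = ((-(n : ℤ) : ℤ) : WithTop ℤ)) :
    D x = 0 ∧ (n : ℕ∞) ≤ analyticOrderAt D x := by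
  have h0 : D x = 0 := by
    by_contra hne
    have := (hE.fun_sub (hQ.fun_div hD hne)).meromorphicOrderAt_nonneg
    rw [h] at this
    have := WithTop.coe_le_coe.1 this
    omega
  refine ⟨h0, ?_⟩
  rcases eq_or_ne (analyticOrderAt D x) ⊤ with htop | htop
  · rw [htop]; exact le_top
  obtain ⟨r, hr⟩ := ENat.ne_top_iff_exists.1 htop
  rw [← hr]
  have hDo : meromorphicOrderAt D x = ((r : ℤ) : WithTop ℤ) := by
    rw [hD.meromorphicOrderAt_eq, ← hr]; rfl
  have hEm := hE.meromorphicOrderAt_nonneg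
  have hQm := hQ.meromorphicOrderAt_nonneg
  have hmer : MeromorphicAt (fun z => -(Q z / D z)) x :=
    (hQ.meromorphicAt.fun_div hD.meromorphicAt).fun_neg
  have hq : ((-(r : ℤ) : ℤ) : WithTop ℤ) ≤ meromorphicOrderAt (fun z => -(Q z / D z)) x := by
    rw [← meromorphicOrderAt_fun_neg, show meromorphicOrderAt (fun z => Q z / D z) x = _ from
      meromorphicOrderAt_div hQ.meromorphicAt hD.meromorphicAt,
      hDo]
    generalize meromorphicOrderAt Q x = o at hQm
    cases o with
    | top => exact le_top
    | coe o =>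
      have h3 : ((o : WithTop ℤ) - ((r : ℤ) : WithTop ℤ)) = ((o - r : ℤ) : WithTop ℤ) := rfl
      rw [h3]
      have := WithTop.coe_le_coe.1 hQm
      exact WithTop.coe_le_coe.2 (by omega)
  have hadd := meromorphicOrderAt_add hE.meromorphicAt hmer
  have hfe : (E + fun z => -(Q z / D z)) = fun z => E z - Q z / D z := by
    ext z; simp [sub_eq_add_neg]
  rw [hfe, h] at hadd
  have hmin : ((-(r : ℤ) : ℤ) : WithTop ℤ) ≤
      min (meromorphicOrderAt E x) (meromorphicOrderAt (fun z => -(Q z / D z)) x) :=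
    le_min (le_trans (WithTop.coe_le_coe.2 (by omega)) hEm) hq
  have := WithTop.coe_le_coe.1 (hmin.trans hadd)
  exact_mod_cast (by omega : n ≤ r)

theorem meromorphicOrderAt_sub_div {E Q D : ℂ → ℂ} {x : ℂ} (hE : AnalyticAt ℂ E x)
    (hQ : AnalyticAt ℂ Q x) (hD : AnalyticAt ℂ D x) (hQx : Q x ≠ 0) {n : ℕ} (hn : 0 < n)
    (hDn : analyticOrderAt D x = n) :
    meromorphicOrderAt (fun z => E z - Q z / D z) x = ((-(n : ℤ) : ℤ) : WithTop ℤ) := by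
  have hDo : meromorphicOrderAt D x = ((n : ℤ) : WithTop ℤ) := by
    rw [hD.meromorphicOrderAt_eq, hDn]; rfl
  have hQo : meromorphicOrderAt Q x = 0 := by
    rw [hQ.meromorphicOrderAt_eq, hQ.analyticOrderAt_eq_zero.2 hQx]; rfl
  have hmer : MeromorphicAt (fun z => -(Q z / D z)) x :=
    (hQ.meromorphicAt.fun_div hD.meromorphicAt).fun_neg
  have hq : meromorphicOrderAt (fun z => -(Q z / D z)) x = ((-(n : ℤ) : ℤ) : WithTop ℤ) := by
    rw [← meromorphicOrderAt_fun_neg, show meromorphicOrderAt (fun z => Q z / D z) x = _ from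
      meromorphicOrderAt_div hQ.meromorphicAt hD.meromorphicAt,
      hDo, hQo]
    simp
  have hlt : meromorphicOrderAt (fun z => -(Q z / D z)) x < meromorphicOrderAt E x := by
    rw [hq]
    exact lt_of_lt_of_le (WithTop.coe_lt_coe.2 (by omega)) hE.meromorphicOrderAt_nonneg
  have := meromorphicOrderAt_add_eq_right_of_lt hE.meromorphicAt hlt
  rw [hq] at this
  rw [← this]
  simp only [sub_eq_add_neg]
  rfl

/-! ### The branches of `τ` on the cut plane and at its rims. -/

namespace DiracPotential

variable {m : ℝ} {z : ℂ}

theorem add_ne_zero_of_mem_cutPlane (hm : 0 < m) (hz : z ∈ cutPlane m) : z + m ≠ 0 := by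
  intro h
  have h1 : z = ((-m : ℝ) : ℂ) := by push_cast; linear_combination h
  refine hz ?_
  rw [h1]
  exact ⟨Complex.ofReal_im _, by simp; linarith⟩

theorem div_mem_slitPlane (hm : 0 < m) (hz : z ∈ cutPlane m) :
    (z - m) / (z + m) ∈ Complex.slitPlane := by
  have hne := Complex.normSq_pos.2 (add_ne_zero_of_mem_cutPlane hm hz)
  rw [Complex.mem_slitPlane_iff]
  by_cases him : z.im = 0
  · left
    have hre : z.re < -m ∨ m < z.re := by
      by_contra! hcon
      exact hz ⟨him, hcon⟩
    rw [Complex.div_re, ← add_div]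
    refine div_pos ?_ hne
    simp only [Complex.sub_re, Complex.add_re, Complex.ofReal_re, Complex.sub_im, Complex.add_im,
      Complex.ofReal_im, him]
    rcases hre with h | h <;> nlinarith
  · right
    rw [Complex.div_im, ← sub_div]
    refine div_ne_zero ?_ hne.ne'
    simp only [Complex.sub_re, Complex.add_re, Complex.ofReal_re, Complex.sub_im, Complex.add_im,
      Complex.ofReal_im]
    have : (z.im - 0) * (z.re + m) - (z.re - m) * (z.im + 0) = 2 * m * z.im := by ring
    rw [this]
    exact mul_ne_zero (by positivity) him

/-- The ratio `f₂ / f₁ = i k / (z + m)` of the components of the free Jost solution. -/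
def jostRatio (m : ℝ) (z : ℂ) : ℂ := Complex.I * principalSqrt ((z - m) / (z + m))

theorem jostRatio_sq (hm : 0 < m) (hz : z ∈ cutPlane m) : jostRatio m z ^ 2 * (z + m) = m - z := by
  have h0 := add_ne_zero_of_mem_cutPlane hm hz
  rw [jostRatio, mul_pow, principalSqrt_sq, Complex.I_sq]
  field_simp
  ring

theorem jostRatio_im_pos (hm : 0 < m) (hz : z ∈ cutPlane m) : 0 < (jostRatio m z).im := by
  simpa [jostRatio] using principalSqrt_re_pos (div_mem_slitPlane hm hz)

theorem analyticAt_jostRatio (hm : 0 < m) (hz : z ∈ cutPlane m) : AnalyticAt ℂ (jostRatio m) z := by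
  refine analyticAt_const.mul ((analyticAt_principalSqrt (div_mem_slitPlane hm hz)).fun_comp
    (f := fun z : ℂ => (z - m) / (z + m)) ?_)
  exact (analyticAt_id.sub analyticAt_const).div (analyticAt_id.add analyticAt_const)
    (add_ne_zero_of_mem_cutPlane hm hz)

theorem upperHalf_subset_cutPlane : upperHalf ⊆ cutPlane m := fun _ hz h => (ne_of_gt hz) h.1

theorem lowerHalf_subset_cutPlane : lowerHalf ⊆ cutPlane m := fun _ hz h => (ne_of_lt hz) h.1

theorem isOpen_upperHalf : IsOpen upperHalf := isOpen_lt continuous_const Complex.continuous_im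

theorem isOpen_lowerHalf : IsOpen lowerHalf := isOpen_lt Complex.continuous_im continuous_const

/-- Put `w = s (z + m)`, so that `τ (z + m) = i w`. Adding the imaginary parts of `s w = z - m` and
`conj s * w = |s|² (z + m)` gives `2 Re s Im w = (1 + |s|²) Im z`, and `Re s > 0`. -/
theorem jostRatio_mul_re_neg (hm : 0 < m) (hz : z ∈ upperHalf) :
    (jostRatio m z * (z + m)).re < 0 := by
  have hz' := upperHalf_subset_cutPlane (m := m) hz
  have hs := principalSqrt_re_pos (div_mem_slitPlane hm hz')
  have h0 := add_ne_zero_of_mem_cutPlane hm hz'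
  rw [jostRatio]
  set s := principalSqrt ((z - m) / (z + m)) with hsdef
  have hsq : s * s * (z + m) = z - m := by
    rw [← sq, hsdef, principalSqrt_sq, div_mul_cancel₀ _ h0]
  have hz1 : 0 < z.im := hz
  have e1 := congrArg Complex.im hsq
  simp only [Complex.mul_re, Complex.mul_im, Complex.add_re, Complex.add_im, Complex.sub_im,
    Complex.ofReal_re, Complex.ofReal_im, add_zero, sub_zero, Complex.I_re, Complex.I_im, zero_mul,
    one_mul, zero_sub, zero_add] at e1 ⊢
  have e2 : 2 * s.re * (s.re * z.im + s.im * (z.re + m)) =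
      (1 + s.re * s.re + s.im * s.im) * z.im := by
    linear_combination e1
  have e3 : 0 < (1 + s.re * s.re + s.im * s.im) * z.im :=
    mul_pos (by nlinarith [mul_self_nonneg s.re, mul_self_nonneg s.im]) hz1
  rw [← e2] at e3
  have := (mul_pos_iff_of_pos_left (by linarith : 0 < 2 * s.re)).1 e3
  linarith

/-- The boundary value on the lower rim of the cut of the ratio `f₂ / f₁`, continued
analytically through the cut. -/
def rimRatio (m : ℝ) (z : ℂ) : ℂ := principalSqrt ((m - z) / (m + z))

theorem add_ne_zero_of_re_mem (hz : z.re ∈ Ioo (-m) m) : (m : ℂ) + z ≠ 0 := fun h => by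
  have := congrArg Complex.re h
  simp at this
  linarith [hz.1]

theorem div_mem_slitPlane_of_re_mem (hz : z.re ∈ Ioo (-m) m) :
    ((m : ℂ) - z) / (m + z) ∈ Complex.slitPlane := by
  have hne := Complex.normSq_pos.2 (add_ne_zero_of_re_mem hz)
  have hm : 0 < m := by linarith [hz.1, hz.2]
  rw [Complex.mem_slitPlane_iff]
  by_cases him : z.im = 0
  · left
    rw [Complex.div_re, ← add_div]
    refine div_pos ?_ hne
    simp only [Complex.sub_re, Complex.add_re, Complex.ofReal_re, Complex.sub_im, Complex.add_im,
      Complex.ofReal_im, him]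
    nlinarith [hz.1, hz.2]
  · right
    rw [Complex.div_im, ← sub_div]
    refine div_ne_zero ?_ hne.ne'
    simp only [Complex.sub_re, Complex.add_re, Complex.ofReal_re, Complex.sub_im, Complex.add_im,
      Complex.ofReal_im]
    have : (0 - z.im) * (m + z.re) - (m - z.re) * (0 + z.im) = -(2 * m * z.im) := by ring
    rw [this]
    exact neg_ne_zero.2 (mul_ne_zero (by positivity) him)

theorem rimRatio_sq (hz : z.re ∈ Ioo (-m) m) : rimRatio m z ^ 2 * (z + m) = m - z := by
  have h0 := add_ne_zero_of_re_mem hz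
  rw [rimRatio, principalSqrt_sq, add_comm z, div_mul_cancel₀ _ h0]

theorem rimRatio_re_pos (hz : z.re ∈ Ioo (-m) m) : 0 < (rimRatio m z).re :=
  principalSqrt_re_pos (div_mem_slitPlane_of_re_mem hz)

theorem analyticAt_rimRatio (hz : z.re ∈ Ioo (-m) m) : AnalyticAt ℂ (rimRatio m) z := by
  refine (analyticAt_principalSqrt (div_mem_slitPlane_of_re_mem hz)).fun_comp
    (f := fun z : ℂ => (m - z) / (m + z)) ?_
  exact (analyticAt_const.sub analyticAt_id).div (analyticAt_const.add analyticAt_id)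
    (add_ne_zero_of_re_mem hz)

theorem rimRatio_ofReal {x : ℝ} (hx : x ∈ Ioo (-m) m) :
    rimRatio m x = (((m - x) / (m + x)) ^ ((2 : ℝ)⁻¹) : ℝ) := by
  rw [Complex.ofReal_cpow (div_nonneg (by linarith [hx.2]) (by linarith [hx.1])), rimRatio,
    principalSqrt]
  push_cast
  rfl

/-- The imaginary part of `τ² |z + m|² = (m - z) conj (z + m)` is `-2 m Im z`, and `Im τ > 0`. The
sign decides which of `±rimRatio` is the boundary value on each rim. -/
theorem jostRatio_re_mul_im_neg (hm : 0 < m) (hz : z ∈ cutPlane m) (hz0 : z.im ≠ 0) :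
    (jostRatio m z).re * z.im < 0 := by
  have h1 := jostRatio_im_pos hm hz
  have h0 := add_ne_zero_of_mem_cutPlane hm hz
  have h2 := jostRatio_sq hm hz
  set τ := jostRatio m z
  have hn := Complex.normSq_pos.2 h0
  have h3 : τ ^ 2 * Complex.normSq (z + m) = (m - z) * star (z + m) := by
    rw [← h2, Complex.star_def, mul_assoc, Complex.mul_conj]
  have h4 := congrArg Complex.im h3
  rw [Complex.im_mul_ofReal] at h4
  simp only [sq, Complex.mul_im, Complex.star_def, Complex.conj_im, Complex.conj_re, Complex.sub_re,
    Complex.sub_im, Complex.add_re, Complex.add_im, Complex.ofReal_re, Complex.ofReal_im] at h4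
  have h5 : τ.re * z.im * (2 * τ.im * Complex.normSq (z + m)) = -(2 * m * z.im ^ 2) := by
    linear_combination z.im * h4
  have h6 : 0 < 2 * m * z.im ^ 2 := by positivity
  by_contra! hcon
  have : 0 ≤ τ.re * z.im * (2 * τ.im * Complex.normSq (z + m)) := by positivity
  linarith

theorem jostRatio_eq_of_re_mem (hm : 0 < m) (hz : z ∈ cutPlane m) (hre : z.re ∈ Ioo (-m) m) :
    jostRatio m z = rimRatio m z ∨ jostRatio m z = -rimRatio m z := by
  have h0 := add_ne_zero_of_mem_cutPlane hm hz
  refine sq_eq_sq_iff_eq_or_eq_neg.1 (mul_right_cancel₀ h0 ?_)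
  rw [jostRatio_sq hm hz, rimRatio_sq hre]

theorem jostRatio_upper (hz : z ∈ upperHalf) (hre : z.re ∈ Ioo (-m) m) :
    jostRatio m z = -rimRatio m z := by
  have hm : 0 < m := by linarith [hre.1, hre.2]
  have hz1 : 0 < z.im := hz
  have h1 := jostRatio_re_mul_im_neg hm (upperHalf_subset_cutPlane hz) hz1.ne'
  refine (jostRatio_eq_of_re_mem hm (upperHalf_subset_cutPlane hz) hre).resolve_left fun h => ?_
  rw [h] at h1
  nlinarith [rimRatio_re_pos hre]

theorem jostRatio_lower (hz : z ∈ lowerHalf) (hre : z.re ∈ Ioo (-m) m) :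
    jostRatio m z = rimRatio m z := by
  have hm : 0 < m := by linarith [hre.1, hre.2]
  have hz1 : z.im < 0 := hz
  have h1 := jostRatio_re_mul_im_neg hm (lowerHalf_subset_cutPlane hz) hz1.ne
  refine (jostRatio_eq_of_re_mem hm (lowerHalf_subset_cutPlane hz) hre).resolve_right fun h => ?_
  rw [h] at h1
  have := rimRatio_re_pos hre
  simp only [Complex.neg_re] at h1
  nlinarith

/-- The cut plane is a chain of four overlapping convex half-planes. -/
theorem isPreconnected_cutPlane (m : ℝ) : IsPreconnected (cutPlane m) := by
  have hR : Convex ℝ {z : ℂ | m < z.re} := convex_halfSpace_re_gt m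
  have hL : Convex ℝ {z : ℂ | z.re < -m} := convex_halfSpace_re_lt (-m)
  have hU : Convex ℝ upperHalf := convex_halfSpace_im_gt 0
  have hD : Convex ℝ lowerHalf := convex_halfSpace_im_lt 0
  have h1 : IsPreconnected (upperHalf ∪ {z : ℂ | m < z.re}) :=
    hU.isPreconnected.union ⟨m + 1, 1⟩ (by simp [upperHalf]) (by simp) hR.isPreconnected
  have h2 : IsPreconnected (upperHalf ∪ {z : ℂ | m < z.re} ∪ lowerHalf) :=
    h1.union ⟨m + 1, -1⟩ (by simp) (by simp [lowerHalf]) hD.isPreconnected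
  have h3 : IsPreconnected (upperHalf ∪ {z : ℂ | m < z.re} ∪ lowerHalf ∪ {z : ℂ | z.re < -m}) :=
    h2.union ⟨-m - 1, -1⟩ (by simp [lowerHalf]) (by simp) hL.isPreconnected
  convert h3 using 1
  ext z
  simp only [cutPlane, upperHalf, lowerHalf, mem_union, mem_ofPred_eq, mem_Icc]
  grind

end DiracPotential

/-! ### Rim poles as zeros of the Jost function. -/

namespace DiracPotential

variable {m : ℝ} {V : DiracPotential} {z : ℂ} {g y w h u : ℝ → ℂ × ℂ} {a b c R γ : ℝ}

/-- `τ` is the analytic continuation through the cut, near `x`, of the ratio `jostRatio m`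
restricted to the half-plane `U`. -/
structure IsRimBranch (m : ℝ) (U : Set ℂ) (τ : ℂ → ℂ) (x : ℝ) : Prop where
  isOpen : IsOpen U
  subset : U ⊆ cutPlane m
  mem_closure : (x : ℂ) ∈ closure U
  analyticAt : AnalyticAt ℂ τ x
  eventually_eq : ∀ᶠ z in 𝓝 (x : ℂ), z ∈ U → jostRatio m z = τ z
  sq_eq : τ x ^ 2 * (x + m) = m - x

theorem eventually_re_mem {x : ℝ} (hx : x ∈ Ioo (-m) m) :
    ∀ᶠ z in 𝓝 (x : ℂ), z.re ∈ Ioo (-m) m :=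
  Complex.continuous_re.continuousAt.eventually (Ioo_mem_nhds hx.1 hx.2)

theorem ofReal_mem_closure_upperHalf (x : ℝ) : (x : ℂ) ∈ closure upperHalf := by
  rw [upperHalf, Complex.closure_setOfPred_lt_im]
  simp

theorem ofReal_mem_closure_lowerHalf (x : ℝ) : (x : ℂ) ∈ closure lowerHalf := by
  rw [lowerHalf, Complex.closure_setOfPred_im_lt]
  simp

theorem isRimBranch_upper {x : ℝ} (hx : x ∈ Ioo (-m) m) :
    IsRimBranch m upperHalf (fun z => -rimRatio m z) x where
  isOpen := isOpen_upperHalf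
  subset := upperHalf_subset_cutPlane
  mem_closure := ofReal_mem_closure_upperHalf x
  analyticAt := (analyticAt_rimRatio (by simpa using hx)).neg
  eventually_eq := (eventually_re_mem hx).mono fun _ hz hU => jostRatio_upper hU hz
  sq_eq := by rw [neg_sq]; exact rimRatio_sq (by simpa using hx)

theorem isRimBranch_lower {x : ℝ} (hx : x ∈ Ioo (-m) m) :
    IsRimBranch m lowerHalf (rimRatio m) x where
  isOpen := isOpen_lowerHalf
  subset := lowerHalf_subset_cutPlane
  mem_closure := ofReal_mem_closure_lowerHalf x
  analyticAt := analyticAt_rimRatio (by simpa using hx)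
  eventually_eq := (eventually_re_mem hx).mono fun _ hz hU => jostRatio_lower hU hz
  sq_eq := rimRatio_sq (by simpa using hx)

theorem differentiable_regularSolution_fst (hV : V.ConditionA) (m : ℝ) (hR : 0 ≤ R) (t : ℝ) :
    Differentiable ℂ fun z => (regularSolution hV m hR z t).1 := fun z =>
  ((BoundedContinuousFunction.evalCLM ℂ (β := ℂ × ℂ) t).differentiableAt.comp z
    (differentiable_regularSolution hV m hR z)).fst

theorem differentiable_regularSolution_snd (hV : V.ConditionA) (m : ℝ) (hR : 0 ≤ R) (t : ℝ) :
    Differentiable ℂ fun z => (regularSolution hV m hR z t).2 := fun z =>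
  ((BoundedContinuousFunction.evalCLM ℂ (β := ℂ × ℂ) t).differentiableAt.comp z
    (differentiable_regularSolution hV m hR z)).snd

theorem analyticAt_jostForm (hV : V.ConditionA) (m : ℝ) (hγ : 0 ≤ γ) {τ : ℂ → ℂ}
    (hτ : AnalyticAt ℂ τ z) : AnalyticAt ℂ (fun z => jostForm hV m hγ (τ z) z) z :=
  ((differentiable_regularSolution_snd hV m hγ γ).analyticAt z).fun_sub
    (hτ.fun_mul ((differentiable_regularSolution_fst hV m hγ γ).analyticAt z))

/-- The numerator of `greenFormula` is analytic. -/
theorem analyticAt_greenFormula_numerator {m ρ : ℝ} {N₁ N₂ C τ : ℂ → ℂ}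
    (hN₁ : Differentiable ℂ N₁) (hN₂ : Differentiable ℂ N₂) (hC : Differentiable ℂ C)
    (hτ : AnalyticAt ℂ τ z) :
    AnalyticAt ℂ
      (fun z => Complex.exp (τ z * (z + m) * ρ) * (N₂ z - τ z * N₁ z) * C z) z :=
  ((((hτ.fun_mul (analyticAt_id.fun_add analyticAt_const)).fun_mul analyticAt_const).cexp').fun_mul
    ((hN₂.analyticAt z).fun_sub (hτ.fun_mul (hN₁.analyticAt z)))).fun_mul (hC.analyticAt z)

theorem meromorphicAt_greenFormula (hV : V.ConditionA) (hγ : 0 ≤ γ) {ρ : ℝ}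
    {E N₁ N₂ C τ : ℂ → ℂ} (hE : Differentiable ℂ E) (hN₁ : Differentiable ℂ N₁)
    (hN₂ : Differentiable ℂ N₂) (hC : Differentiable ℂ C) (hτ : AnalyticAt ℂ τ z) :
    MeromorphicAt
      (fun z => greenFormula m ρ E N₁ N₂ C (jostForm hV m hγ) (τ z) z) z :=
  (hE.analyticAt z).meromorphicAt.fun_sub
    ((analyticAt_greenFormula_numerator hN₁ hN₂ hC hτ).meromorphicAt.fun_div
      (analyticAt_jostForm hV m hγ hτ).meromorphicAt)

/-- The pole order does not depend on the chosen continuation `G` or extension `F`: both are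
determined by the values on the upper half-plane, so `F` may be replaced by the explicit formula
`G₁`. -/
theorem IsRimBranch.order_eq {U : Set ℂ} {τ G G₀ G₁ F : ℂ → ℂ} {x : ℝ}
    (hx : x ∈ Ioo (-m) m) (hU : IsRimBranch m U τ x)
    (hG : MeromorphicOn G (cutPlane m)) (hG₀ : MeromorphicOn G₀ (cutPlane m))
    (heq : EqOn G G₀ upperHalf) (hG₁ : MeromorphicAt G₁ x)
    (hG₀₁ : ∀ᶠ z in 𝓝 (x : ℂ), z ∈ U → G₀ z = G₁ z) (hF : MeromorphicAt F x)
    (hFG : F =ᶠ[𝓝[U] (x : ℂ)] G) : meromorphicOrderAt F x = meromorphicOrderAt G₁ x := by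
  refine meromorphicOrderAt_congr ?_
  have hI : Complex.I ∈ upperHalf := by simp [upperHalf]
  -- Identity theorem on the connected cut plane; meromorphic functions agree only off a discrete
  -- set.
  have htop : ∀ z ∈ cutPlane m, ∀ᶠ w in 𝓝[≠] z, G w = G₀ w := by
    intro z hz
    have h1 : meromorphicOrderAt (G - G₀) Complex.I = ⊤ := by
      rw [meromorphicOrderAt_eq_top_iff]
      refine Filter.Eventually.filter_mono nhdsWithin_le_nhds ?_
      filter_upwards [isOpen_upperHalf.mem_nhds hI] with w hw
      simp [heq hw]
    have h2 : meromorphicOrderAt (G - G₀) z = ⊤ := by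
      by_contra hne
      exact (hG.sub hG₀).meromorphicOrderAt_ne_top_of_isPreconnected (isPreconnected_cutPlane m)
        hz (upperHalf_subset_cutPlane hI) hne h1
    filter_upwards [meromorphicOrderAt_eq_top_iff.1 h2] with w hw
    exact sub_eq_zero.1 hw
  rcases (hF.sub hG₁).eventually_eq_zero_or_eventually_ne_zero with h | h
  · filter_upwards [h] with z hz
    exact sub_eq_zero.1 hz
  · exfalso
    rw [eventually_nhdsWithin_iff] at h
    have hFG' : ∀ᶠ z in 𝓝 (x : ℂ), z ∈ U → F z = G z := eventually_nhdsWithin_iff.1 hFG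
    -- A point `z` of `U` near `x` may be exceptional for `G = G₀`, so it is perturbed to a nearby
    -- `w` in `U`, where `F = G = G₀ = G₁`.
    obtain ⟨z, hz, hzU⟩ := (mem_closure_iff_frequently.1 hU.mem_closure).and_eventually
      ((h.and (hFG'.and hG₀₁)).eventually_nhds) |>.exists
    have h1 : ∀ᶠ w in 𝓝[≠] z, G w = G₀ w := htop z (hU.subset hz)
    have h2 : ∀ᶠ w in 𝓝[≠] z, w ∈ U := nhdsWithin_le_nhds (hU.isOpen.mem_nhds hz)
    obtain ⟨w, hw1, hw2, hw3, hw4, hw5⟩ :=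
      (h1.and (h2.and (hzU.filter_mono nhdsWithin_le_nhds))).exists
    have hwx : w ≠ x := by
      rintro rfl
      exact hU.subset hw2 ⟨Complex.ofReal_im x, by simpa using Ioo_subset_Icc_self hx⟩
    refine hw3 hwx ?_
    rw [Pi.sub_apply, hw4 hw2, hw1, hw5 hw2, sub_self]

theorem jostForm_jostRatio_ne_zero (hV : V.ConditionA) (hm : 0 < m) (hγ : 0 < γ)
    (hz : z ∈ upperHalf) : jostForm hV m hγ.le (jostRatio m z) z ≠ 0 :=
  jostForm_ne_zero hV m hγ hz (jostRatio_im_pos hm (upperHalf_subset_cutPlane hz))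

theorem jostForm_eq_zero_of_hasStatePole (hV : V.ConditionA) (hm : 0 < m)
    (hV0 : V.VanishesBeyond γ) (hγ : 0 < γ) {U : Set ℂ} {τ : ℂ → ℂ} {x : ℝ} {n : ℕ}
    (hx : x ∈ Ioo (-m) m) (hU : IsRimBranch m U τ x) (hp : HasStatePole m V U x n) :
    jostForm hV m hγ.le (τ x) x = 0 ∧
      (n : ℕ∞) ≤ analyticOrderAt (fun z => jostForm hV m hγ.le (τ z) z) x := by
  obtain ⟨h, hh, G, hG, hn, F, hF, hFG, hFn⟩ := hp
  obtain ⟨R₀, hR₀⟩ := hh.compact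
  obtain ⟨E, N₁, N₂, C, ⟨hE, hN₁, hN₂, hC⟩, hres, -, -⟩ := exists_greenFormula (m := m) hV hV0 hγ
    (le_max_left γ R₀) hh (fun x hx => hR₀ x (lt_of_le_of_lt (le_max_right _ _) hx))
  rw [hU.order_eq hx hG.meromorphicOn (fun z hz => meromorphicAt_greenFormula (m := m) hV hγ.le
    (ρ := max γ R₀ - γ) hE hN₁ hN₂ hC (analyticAt_jostRatio hm hz)) (fun z hz => ?_)
    (meromorphicAt_greenFormula (m := m) hV hγ.le (ρ := max γ R₀ - γ) hE hN₁ hN₂ hC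
      hU.analyticAt) (hU.eventually_eq.mono fun z hz hzU => ?_) hF hFG] at hFn
  · exact meromorphicOrderAt_sub_div_of_neg (hE.analyticAt _)
      (analyticAt_greenFormula_numerator hN₁ hN₂ hC hU.analyticAt)
      (analyticAt_jostForm hV m hγ.le hU.analyticAt) hn hFn
  · obtain ⟨u, hu, hGu⟩ := hG.eq_resolvent z hz
    rw [hGu]
    exact (hres z _ (jostRatio_sq hm (upperHalf_subset_cutPlane hz)) (jostRatio_mul_re_neg hm hz)
      (jostForm_jostRatio_ne_zero hV hm hγ hz)).2 u hu
  · simp only [hz hzU]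

/-- With `h = χ φ(·, x)`, both factors of the numerator that could vanish at `x` are governed by `∫
χ |φ|² > 0`, as `φ` is real for real `x`. The pole then has the full order of the zero. -/
theorem hasStatePole_of_jostForm_eq_zero (hV : V.ConditionA) (hm : 0 < m)
    (hV0 : V.VanishesBeyond γ) (hγ : 0 < γ) {U : Set ℂ} {τ : ℂ → ℂ} {x : ℝ} {n : ℕ}
    (hU : IsRimBranch m U τ x) (hD : jostForm hV m hγ.le (τ x) x = 0)
    (hn : analyticOrderAt (fun z => jostForm hV m hγ.le (τ z) z) x = n) :
    HasStatePole m V U x n := by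
  set φ := regularSolution hV m hγ.le (x : ℂ) with hφ
  -- Positive on `(0, γ)` and zero beyond, so `h` is continuous with support in `[0, γ]` and `R = γ`
  -- is allowed.
  let χ : ℝ → ℝ := fun t => max (γ - t) 0
  have hχ : Continuous χ := by fun_prop
  let h : ℝ → ℂ × ℂ := fun t => (χ t : ℂ) • φ t
  have hh : IsTest h := by
    refine ⟨((Complex.continuous_ofReal.comp hχ).smul φ.continuous).continuousOn,
      ⟨γ, fun t ht => ?_⟩, 0, le_rfl, ?_⟩
    · simp [h, χ, max_eq_right (sub_nonpos.2 ht.le)]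
    · simp [h, χ, hφ, regularSolution_zero, Prod.ext_iff, max_eq_left hγ.le, hγ.ne']
  have hhγ : ∀ t, γ < t → h t = 0 := fun t ht => by
    simp [h, χ, max_eq_right (sub_nonpos.2 ht.le)]
  have hreal : ∀ t ∈ Icc 0 γ, star (φ t) = φ t := fun t ht => by
    have := regularSolution_conj hV m hγ.le (x : ℂ) t ht
    rw [Complex.star_def, Complex.conj_ofReal] at this
    exact this.symm
  have hpos := integral_normSq_regularSolution_pos hV m hγ (x : ℂ) hχ
    fun t ht => lt_max_of_lt_left (sub_pos.2 ht.2)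
  have hint1 : ∫ t in (0 : ℝ)..γ, ((φ t).1 * (h t).1 + (φ t).2 * (h t).2) ≠ 0 := by
    have : ∫ t in (0 : ℝ)..γ, ((φ t).1 * (h t).1 + (φ t).2 * (h t).2) =
        ((∫ t in (0 : ℝ)..γ, (Complex.normSq (φ t).1 + Complex.normSq (φ t).2) * χ t : ℝ) : ℂ) := by
      rw [← intervalIntegral.integral_ofReal]
      refine intervalIntegral.integral_congr fun t ht => ?_
      rw [uIcc_of_le hγ.le] at ht
      have e := hreal t ht
      have e1 : star (φ t).1 = (φ t).1 := congrArg Prod.fst e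
      have e2 : star (φ t).2 = (φ t).2 := congrArg Prod.snd e
      have k1 : (Complex.normSq (φ t).1 : ℂ) = (φ t).1 * (φ t).1 := by
        rw [← Complex.mul_conj, ← Complex.star_def, e1]
      have k2 : (Complex.normSq (φ t).2 : ℂ) = (φ t).2 * (φ t).2 := by
        rw [← Complex.mul_conj, ← Complex.star_def, e2]
      simp only [h, Prod.smul_fst, Prod.smul_snd, smul_eq_mul]
      push_cast
      rw [k1, k2]
      ring
    rw [this]
    exact Complex.ofReal_ne_zero.2 hpos.ne'
  have hint2 : ∫ t in (0 : ℝ)..γ, ((φ t).1 * (star (h t)).1 + (φ t).2 * (star (h t)).2) ≠ 0 := by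
    convert hint1 using 1
    refine intervalIntegral.integral_congr fun t ht => ?_
    rw [uIcc_of_le hγ.le] at ht
    have e : star (h t) = h t := by
      simp only [h, star_smul, hreal t ht, Complex.star_def, Complex.conj_ofReal]
    simp only [e]
  obtain ⟨E, N₁, N₂, C, ⟨hE, hN₁, hN₂, hC⟩, hres, hCz, hN⟩ :=
    exists_greenFormula (m := m) hV hV0 hγ le_rfl hh hhγ
  have hn0 : 0 < n := by
    rcases Nat.eq_zero_or_pos n with h0 | h0
    · rw [h0] at hn
      exact absurd hD
        ((analyticAt_jostForm hV m hγ.le hU.analyticAt).analyticOrderAt_eq_zero.1 hn)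
    · exact h0
  refine ⟨h, hh, fun z => greenFormula m (γ - γ) E N₁ N₂ C (jostForm hV m hγ.le)
    (jostRatio m z) z, ⟨fun z hz => meromorphicAt_greenFormula hV hγ.le hE hN₁ hN₂ hC
      (analyticAt_jostRatio hm hz), fun z hz => ?_⟩, hn0,
      fun z => greenFormula m (γ - γ) E N₁ N₂ C (jostForm hV m hγ.le) (τ z) z,
      meromorphicAt_greenFormula hV hγ.le hE hN₁ hN₂ hC hU.analyticAt, ?_, ?_⟩
  · obtain ⟨⟨u, hu⟩, h2⟩ := hres z _ (jostRatio_sq hm (upperHalf_subset_cutPlane hz))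
      (jostRatio_mul_re_neg hm hz) (jostForm_jostRatio_ne_zero hV hm hγ hz)
    exact ⟨u, hu, (h2 u hu).symm⟩
  · rw [EventuallyEq, eventually_nhdsWithin_iff]
    filter_upwards [hU.eventually_eq] with z hz hzU
    simp only [hz hzU]
  · refine meromorphicOrderAt_sub_div (hE.analyticAt _)
      (analyticAt_greenFormula_numerator hN₁ hN₂ hC hU.analyticAt)
      (analyticAt_jostForm hV m hγ.le hU.analyticAt) ?_ hn0 hn
    obtain ⟨κ, hκ⟩ := hN x (τ x) hU.sq_eq hD
    refine mul_ne_zero (mul_ne_zero (Complex.exp_ne_zero _) fun h0 => ?_) ?_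
    · rw [h0, mul_zero, zero_eq_neg] at hκ
      exact hint1 hκ
    · rw [hCz]
      exact hint2

end DiracPotential

/-! ### Parity of the number of zeros. -/

/-- The parity of the number of zeros, with multiplicity, between two points of opposite sign. -/
theorem odd_sum_of_mul_neg {F : ℝ → ℝ} {a b : ℝ} (hab : a ≤ b) (hF : ContinuousOn F (Icc a b))
    {S : Finset ℝ} (hS : ∀ x ∈ S, x ∈ Ioo a b) (hzero : ∀ x ∈ Icc a b, x ∉ S → F x ≠ 0)
    {r : ℝ → ℕ} {G : ℝ → ℝ → ℝ} (hG : ∀ s ∈ S, ContinuousAt (G s) s) (hG0 : ∀ s ∈ S, G s s ≠ 0)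
    (hFG : ∀ s ∈ S, ∀ᶠ x in 𝓝 s, F x = (x - s) ^ r s * G s x) (hneg : F a * F b < 0) :
    Odd (∑ s ∈ S, r s) := by
  classical
  let P : Finset ℝ → ℝ → ℝ := fun T x => ∏ t ∈ T, (x - t) ^ r t
  have hPc : ∀ T, Continuous (P T) := fun T => by fun_prop
  have hP0 : ∀ (T : Finset ℝ) x, x ∉ T → P T x ≠ 0 := fun T x hx =>
    Finset.prod_ne_zero_iff.2 fun t ht => pow_ne_zero _ (sub_ne_zero.2 fun h => hx (h ▸ ht))
  -- The quotient of `F` by the polynomial carrying its zeros, with removable singularities filled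
  -- in: continuous and nowhere zero, hence of constant sign.
  let Q : ℝ → ℝ := fun x => if x ∈ S then G x x / P (S.erase x) x else F x / P S x
  have hQs : ∀ s ∈ S, Q =ᶠ[𝓝 s] fun x => G s x / P (S.erase s) x := by
    intro s hs
    have hne : ∀ᶠ x in 𝓝 s, x ∉ S.erase s :=
      (S.erase s).finite_toSet.isClosed.isOpen_compl.mem_nhds (by simp)
    filter_upwards [hFG s hs, hne] with x hx hxe
    by_cases hxs : x = s
    · simp [Q, hxs, hs]
    · have hxS : x ∉ S := fun h => hxe (Finset.mem_erase.2 ⟨hxs, h⟩)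
      simp only [Q, hxS, if_false]
      have h1 : P S x = (x - s) ^ r s * P (S.erase s) x := (Finset.mul_prod_erase S _ hs).symm
      rw [hx, h1, mul_div_mul_left _ _ (pow_ne_zero _ (sub_ne_zero.2 hxs))]
  have hQ0 : ∀ x ∈ Icc a b, Q x ≠ 0 := by
    intro x hx
    by_cases hxS : x ∈ S
    · simp only [Q, hxS, if_true]
      exact div_ne_zero (hG0 x hxS) (hP0 _ _ (by simp))
    · simp only [Q, hxS, if_false]
      exact div_ne_zero (hzero x hx hxS) (hP0 _ _ hxS)
  have hQc : ContinuousOn Q (Icc a b) := by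
    intro x hx
    by_cases hxS : x ∈ S
    · exact (((hG x hxS).div (hPc _).continuousAt (hP0 _ _ (by simp))).congr
        (hQs x hxS).symm).continuousWithinAt
    · have hne : ∀ᶠ y in 𝓝 x, y ∉ S := S.finite_toSet.isClosed.isOpen_compl.mem_nhds (by simpa)
      refine ((hF x hx).div (hPc S).continuousWithinAt (hP0 _ _ hxS)).congr_of_eventuallyEq
        (nhdsWithin_le_nhds (hne.mono fun y hy => ?_)) ?_
      · simp only [Q, hy, if_false, Pi.div_apply]
      · simp only [Q, hxS, if_false, Pi.div_apply]
  have hmem : ∀ s ∈ S, a < s ∧ s < b := hS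
  have haS : a ∉ S := fun h => lt_irrefl _ (hmem a h).1
  have hbS : b ∉ S := fun h => lt_irrefl _ (hmem b h).2
  have hQab : 0 < Q a * Q b := by
    by_contra! hle
    have h0 : (0 : ℝ) ∈ Q '' Icc a b := by
      rcases mul_nonpos_iff.1 hle with h | h
      · exact intermediate_value_Icc' hab hQc ⟨h.2, h.1⟩
      · exact intermediate_value_Icc hab hQc ⟨h.1, h.2⟩
    obtain ⟨x, hx, hx0⟩ := h0
    exact hQ0 x hx hx0
  have hFa : F a = P S a * Q a := by
    simp only [Q, haS, if_false]
    rw [mul_div_cancel₀ _ (hP0 S a haS)]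
  have hFb : F b = P S b * Q b := by
    simp only [Q, hbS, if_false]
    rw [mul_div_cancel₀ _ (hP0 S b hbS)]
  have hPb : 0 < P S b := Finset.prod_pos fun s hs => pow_pos (sub_pos.2 (hmem s hs).2) _
  have hPa : P S a = (-1) ^ (∑ s ∈ S, r s) * ∏ s ∈ S, (s - a) ^ r s := by
    rw [← Finset.prod_pow_eq_pow_sum, ← Finset.prod_mul_distrib]
    refine Finset.prod_congr rfl fun s _ => ?_
    rw [← mul_pow]
    ring
  have hPa' : 0 < ∏ s ∈ S, (s - a) ^ r s :=
    Finset.prod_pos fun s hs => pow_pos (sub_pos.2 (hmem s hs).1) _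
  by_contra hodd
  rw [Nat.not_odd_iff_even] at hodd
  rw [hodd.neg_one_pow, one_mul] at hPa
  rw [hFa, hFb, hPa] at hneg
  have : 0 < (∏ s ∈ S, (s - a) ^ r s) * P S b * (Q a * Q b) := by positivity
  linarith

/-- Since `f a ≠ 0`, the zeros are isolated with finite order, and compactness of `[a, b]` makes
them finitely many. Local factorisations then feed `odd_sum_of_mul_neg`. -/
theorem exists_zeros_odd {f : ℂ → ℂ} {Ω : Set ℂ} (hΩ : IsPreconnected Ω)
    (hf : AnalyticOnNhd ℂ f Ω) {a b : ℝ} (hab : a ≤ b) (hsub : ∀ x ∈ Icc a b, (x : ℂ) ∈ Ω)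
    {F : ℝ → ℝ} (hF : ∀ x ∈ Icc a b, f x = F x) (hneg : F a * F b < 0) :
    ∃ (S : Finset ℝ) (r : ℝ → ℕ), (∀ x : ℝ, x ∈ S ↔ x ∈ Ioo a b ∧ f x = 0) ∧
      (∀ x ∈ S, analyticOrderAt f x = r x) ∧ Odd (∑ x ∈ S, r x) := by
  have ha : a ∈ Icc a b := ⟨le_rfl, hab⟩
  have hb : b ∈ Icc a b := ⟨hab, le_rfl⟩
  have hFa : F a ≠ 0 := fun h => by simp [h] at hneg
  have hFb : F b ≠ 0 := fun h => by simp [h] at hneg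
  have hfa : f a ≠ 0 := by rw [hF a ha]; exact Complex.ofReal_ne_zero.2 hFa
  have hnf : ∀ z ∈ Ω, ¬ ∃ᶠ w in 𝓝[≠] z, f w = 0 := fun z hz h =>
    hfa (hf.eqOn_zero_of_preconnected_of_frequently_eq_zero hΩ hz h (hsub a ha))
  have hfin : {x : ℝ | x ∈ Ioo a b ∧ f x = 0}.Finite := by
    by_contra hinf
    have h1 : ((fun x : ℝ => (x : ℂ)) '' {x : ℝ | x ∈ Ioo a b ∧ f x = 0}).Infinite :=
      Set.Infinite.image Complex.ofReal_injective.injOn hinf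
    obtain ⟨z, ⟨x, hx, rfl⟩, hz⟩ := h1.exists_accPt_of_subset_isCompact
      (isCompact_Icc.image Complex.continuous_ofReal : IsCompact ((fun x : ℝ => (x : ℂ)) '' Icc a b))
      (image_mono fun x hx => Ioo_subset_Icc_self hx.1)
    refine hnf x (hsub x hx) ((accPt_iff_frequently_nhdsNE.1 hz).mono ?_)
    rintro _ ⟨y, hy, rfl⟩
    exact hy.2
  set S := hfin.toFinset with hS
  have hmem : ∀ x : ℝ, x ∈ S ↔ x ∈ Ioo a b ∧ f x = 0 := fun x => by simp [hS]
  have hloc : ∀ x ∈ S, ∃ (n : ℕ) (G : ℝ → ℝ), analyticOrderAt f x = n ∧ ContinuousAt G x ∧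
      G x ≠ 0 ∧ ∀ᶠ y in 𝓝 x, F y = (y - x) ^ n * G y := by
    intro x hx
    have hxI := ((hmem x).1 hx).1
    have hxΩ := hsub x (Ioo_subset_Icc_self hxI)
    have htop : analyticOrderAt f x ≠ ⊤ := fun h =>
      hnf x hxΩ ((analyticOrderAt_eq_top.1 h).filter_mono nhdsWithin_le_nhds).frequently
    obtain ⟨n, hn⟩ := ENat.ne_top_iff_exists.1 htop
    obtain ⟨g, hg, hg0, hfg⟩ := ((hf x hxΩ).analyticOrderAt_eq_natCast).1 hn.symm
    have hofr : Tendsto (fun y : ℝ => (y : ℂ)) (𝓝 x) (𝓝 (x : ℂ)) :=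
      Complex.continuous_ofReal.continuousAt
    have hgc : ContinuousAt (fun y : ℝ => g y) x := hg.continuousAt.comp hofr
    have hFg : ∀ᶠ y in 𝓝 x, ((F y : ℝ) : ℂ) = (((y - x) ^ n : ℝ) : ℂ) * g y := by
      filter_upwards [hofr.eventually hfg, Icc_mem_nhds hxI.1 hxI.2] with y hy hyI
      rw [← hF y hyI, hy, smul_eq_mul]
      push_cast
      rfl
    -- The cofactor `g` is real at nearby real points other than `x`, hence at `x` by continuity; so
    -- its real part does not vanish there.
    have him : (g x).im = 0 := by
      have h1 : Tendsto (fun y : ℝ => (g y).im) (𝓝[≠] x) (𝓝 (g x).im) :=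
        (Complex.continuous_im.continuousAt.comp hgc).tendsto.mono_left nhdsWithin_le_nhds
      have h2 : (fun y : ℝ => (g y).im) =ᶠ[𝓝[≠] x] fun _ => 0 := by
        filter_upwards [nhdsWithin_le_nhds hFg, self_mem_nhdsWithin] with y hy hyx
        have h3 := congrArg Complex.im hy
        rw [Complex.ofReal_im, Complex.im_ofReal_mul] at h3
        exact (mul_eq_zero.1 h3.symm).resolve_left (pow_ne_zero _ (sub_ne_zero.2 hyx))
      exact tendsto_nhds_unique (h1.congr' h2) tendsto_const_nhds
    refine ⟨n, fun y => (g y).re, hn.symm, Complex.continuous_re.continuousAt.comp hgc,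
      fun h => hg0 (Complex.ext h him), hFg.mono fun y hy => ?_⟩
    have h3 := congrArg Complex.re hy
    rwa [Complex.ofReal_re, Complex.re_ofReal_mul] at h3
  choose! r G hr hGc hG0 hFG using hloc
  refine ⟨S, r, hmem, hr, odd_sum_of_mul_neg (F := F) hab ?_ (fun x hx => ((hmem x).1 hx).1) ?_
    hGc hG0 hFG hneg⟩
  · have h1 : ContinuousOn (fun x : ℝ => (f x).re) (Icc a b) := fun x hx =>
      (Complex.continuous_re.continuousAt.comp ((hf x (hsub x hx)).continuousAt.comp
        Complex.continuous_ofReal.continuousAt)).continuousWithinAt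
    exact h1.congr fun x hx => by simp only [hF x hx, Complex.ofReal_re]
  · intro x hx hxS hF0
    refine hxS ((hmem x).2 ⟨⟨lt_of_le_of_ne hx.1 ?_, lt_of_le_of_ne hx.2 ?_⟩, by
      rw [hF x hx, hF0, Complex.ofReal_zero]⟩)
    · rintro rfl; exact hFa hF0
    · rintro rfl; exact hFb hF0

/-! ### Real Jost functions on the two rims and their signs. -/

namespace DiracPotential

variable {m : ℝ} {V : DiracPotential} {γ : ℝ}

/-- The first component at `γ` of the regular solution for a real spectral parameter. -/
def regularFst (hV : V.ConditionA) (m : ℝ) (hγ : 0 ≤ γ) (x : ℝ) : ℝ :=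
  (regularSolution hV m hγ x γ).1.re

/-- The second component at `γ` of the regular solution for a real spectral parameter. -/
def regularSnd (hV : V.ConditionA) (m : ℝ) (hγ : 0 ≤ γ) (x : ℝ) : ℝ :=
  (regularSolution hV m hγ x γ).2.re

theorem regularSolution_ofReal_im (hV : V.ConditionA) (m : ℝ) (hγ : 0 ≤ γ) (x : ℝ) {t : ℝ}
    (ht : t ∈ Icc 0 γ) : (regularSolution hV m hγ x t).1.im = 0 ∧
      (regularSolution hV m hγ x t).2.im = 0 := by
  have := regularSolution_conj hV m hγ (x : ℂ) t ht
  rw [Complex.star_def, Complex.conj_ofReal] at this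
  exact ⟨Complex.conj_eq_iff_im.1 (congrArg Prod.fst this).symm,
    Complex.conj_eq_iff_im.1 (congrArg Prod.snd this).symm⟩

theorem ofReal_regularFst (hV : V.ConditionA) (m : ℝ) (hγ : 0 ≤ γ) (x : ℝ) :
    (regularFst hV m hγ x : ℂ) = (regularSolution hV m hγ x γ).1 :=
  Complex.ext rfl (regularSolution_ofReal_im hV m hγ x ⟨hγ, le_rfl⟩).1.symm

theorem ofReal_regularSnd (hV : V.ConditionA) (m : ℝ) (hγ : 0 ≤ γ) (x : ℝ) :
    (regularSnd hV m hγ x : ℂ) = (regularSolution hV m hγ x γ).2 :=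
  Complex.ext rfl (regularSolution_ofReal_im hV m hγ x ⟨hγ, le_rfl⟩).2.symm

theorem continuous_regularFst (hV : V.ConditionA) (m : ℝ) (hγ : 0 ≤ γ) :
    Continuous (regularFst hV m hγ) :=
  Complex.continuous_re.comp
    ((differentiable_regularSolution_fst hV m hγ γ).continuous.comp Complex.continuous_ofReal)

theorem continuous_regularSnd (hV : V.ConditionA) (m : ℝ) (hγ : 0 ≤ γ) :
    Continuous (regularSnd hV m hγ) :=
  Complex.continuous_re.comp
    ((differentiable_regularSolution_snd hV m hγ γ).continuous.comp Complex.continuous_ofReal)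

/-- Lagrange's identity: `φ₂ / φ₁` at `γ` is decreasing in the spectral parameter. -/
theorem eventually_regular_wronskian (hV : V.ConditionA) (m : ℝ) (hγ : 0 < γ) (x : ℝ) :
    ∀ᶠ y in 𝓝 x, ∃ K : ℝ, 0 < K ∧ regularFst hV m hγ.le x * regularSnd hV m hγ.le y -
      regularSnd hV m hγ.le x * regularFst hV m hγ.le y = (x - y) * K := by
  set φ := regularSolution hV m hγ.le with hφ
  obtain ⟨L, hL⟩ := exists_pairing (g := φ x) hγ.le
    ((φ x).continuous.integrableOn_Icc.mono_set Ioc_subset_Icc_self)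
  -- The constant `K` is the pairing of `φ(·, y)` with `φ(·, x)`: it is `∫ |φ|² > 0` at `y = x` and
  -- stays positive nearby.
  have hc : Continuous fun y : ℝ => (L (φ y)).re :=
    Complex.continuous_re.comp (L.continuous.comp
      ((differentiable_regularSolution hV m hγ.le).continuous.comp Complex.continuous_ofReal))
  have hpos : 0 < (L (φ x)).re := by
    have h1 := integral_normSq_regularSolution_pos hV m hγ (x : ℂ)
      (continuous_const (y := (1 : ℝ))) fun _ _ => one_pos
    have h2 : L (φ x) = ((∫ t in (0 : ℝ)..γ, (Complex.normSq (φ x t).1 +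
        Complex.normSq (φ x t).2) * 1 : ℝ) : ℂ) := by
      rw [hL, ← intervalIntegral.integral_ofReal]
      refine intervalIntegral.integral_congr fun t ht => ?_
      rw [uIcc_of_le hγ.le] at ht
      obtain ⟨h3, h4⟩ := regularSolution_ofReal_im hV m hγ.le x ht
      have k1 := Complex.mul_conj (φ x t).1
      have k2 := Complex.mul_conj (φ x t).2
      rw [Complex.conj_eq_iff_im.2 h3] at k1
      rw [Complex.conj_eq_iff_im.2 h4] at k2
      push_cast
      linear_combination k1 + k2
    rw [h2, Complex.ofReal_re]
    exact h1
  filter_upwards [hc.continuousAt.eventually (lt_mem_nhds hpos)] with y hy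
  refine ⟨_, hy, ?_⟩
  have h1 := ((isSolOn_regularSolution hV m hγ.le (x : ℂ)).lagrange
    (isSolOn_regularSolution hV m hγ.le (y : ℂ)) hγ.le).eq_integral γ ⟨hγ.le, le_rfl⟩
  have h2 : ∫ t in (0 : ℝ)..γ, (((x : ℂ) - y) * ((φ x t).1 * (φ y t).1 + (φ x t).2 * (φ y t).2) +
      (((0 : ℝ → ℂ × ℂ) t).1 * (φ y t).1 + ((0 : ℝ → ℂ × ℂ) t).2 * (φ y t).2) -
      ((φ x t).1 * ((0 : ℝ → ℂ × ℂ) t).1 + (φ x t).2 * ((0 : ℝ → ℂ × ℂ) t).2)) =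
      ((x : ℂ) - y) * L (φ y) := by
    rw [hL, ← intervalIntegral.integral_const_mul]
    refine intervalIntegral.integral_congr fun t _ => ?_
    simp only [Pi.zero_apply, Prod.fst_zero, Prod.snd_zero]
    ring
  have h3 : wronskian (φ x) (φ y) 0 = 0 := by
    simp [wronskian, hφ, regularSolution_zero]
  rw [← hφ, h2, h3, zero_add, wronskian, hφ, ← ofReal_regularFst, ← ofReal_regularSnd,
    ← ofReal_regularFst, ← ofReal_regularSnd, ← Complex.ofReal_sub] at h1
  have h4 := congrArg Complex.re h1
  rw [Complex.re_ofReal_mul] at h4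
  rw [← h4]
  simp

/-- The positive square root `√((m - x) / (m + x))`. -/
def rimRoot (m x : ℝ) : ℝ := ((m - x) / (m + x)) ^ ((2 : ℝ)⁻¹)

theorem rimRoot_pos {x : ℝ} (hx : x ∈ Ioo (-m) m) : 0 < rimRoot m x :=
  Real.rpow_pos_of_pos (div_pos (by linarith [hx.2]) (by linarith [hx.1])) _

theorem rimRoot_lt {x y : ℝ} (hx : x ∈ Ioo (-m) m) (hy : y ∈ Ioo (-m) m) (hxy : x < y) :
    rimRoot m y < rimRoot m x := by
  have h1 : 0 < m + x := by linarith [hx.1]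
  have h2 : 0 < m + y := by linarith [hy.1]
  refine Real.rpow_lt_rpow (div_nonneg (by linarith [hy.2]) h2.le) ?_ (by norm_num)
  rw [div_lt_div_iff₀ h2 h1]
  nlinarith [hx.1, hx.2]

theorem continuousAt_rimRoot {x : ℝ} (hx : x ∈ Ioo (-m) m) : ContinuousAt (rimRoot m) x := by
  have h1 : m + x ≠ 0 := by linarith [hx.1]
  exact ((continuousAt_const.sub continuousAt_id).div (continuousAt_const.add continuousAt_id)
    h1).rpow_const (Or.inr (by norm_num))

/-- The Jost function on the upper (`s = 1`) and lower (`s = -1`) rim of the cut. -/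
def rimForm (hV : V.ConditionA) (m : ℝ) (hγ : 0 ≤ γ) (s x : ℝ) : ℝ :=
  regularSnd hV m hγ x + s * (regularFst hV m hγ x * rimRoot m x)

theorem jostForm_rimRatio (hV : V.ConditionA) (hγ : 0 ≤ γ) {x : ℝ} (hx : x ∈ Ioo (-m) m) :
    jostForm hV m hγ (rimRatio m x) x = rimForm hV m hγ (-1) x := by
  rw [jostForm, ← ofReal_regularFst, ← ofReal_regularSnd, rimRatio_ofReal hx, rimForm, rimRoot]
  push_cast
  ring

theorem jostForm_neg_rimRatio (hV : V.ConditionA) (hγ : 0 ≤ γ) {x : ℝ} (hx : x ∈ Ioo (-m) m) :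
    jostForm hV m hγ (-rimRatio m x) x = rimForm hV m hγ 1 x := by
  rw [jostForm, ← ofReal_regularFst, ← ofReal_regularSnd, rimRatio_ofReal hx, rimForm, rimRoot]
  push_cast
  ring

theorem continuousAt_rimForm (hV : V.ConditionA) (hγ : 0 ≤ γ) (s : ℝ) {x : ℝ}
    (hx : x ∈ Ioo (-m) m) : ContinuousAt (rimForm hV m hγ s) x :=
  (continuous_regularSnd hV m hγ).continuousAt.add (continuousAt_const.mul
    ((continuous_regularFst hV m hγ).continuousAt.mul (continuousAt_rimRoot hx)))

theorem regularFst_ne_zero (hV : V.ConditionA) (hγ : 0 ≤ γ) {s x : ℝ}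
    (h : rimForm hV m hγ s x = 0) : regularFst hV m hγ x ≠ 0 := by
  intro h0
  have h1 : regularSnd hV m hγ x = 0 := by simpa [rimForm, h0] using h
  refine regularSolution_ne_zero hV m hγ (x : ℂ) ⟨hγ, le_rfl⟩ (Prod.ext ?_ ?_)
  · rw [← ofReal_regularFst, h0]; simp
  · rw [← ofReal_regularSnd, h1]; simp

/-- The sign of the Jost function next to a zero on the upper rim. -/
theorem eventually_rimForm_sign (hV : V.ConditionA) (hγ : 0 < γ) {x : ℝ} (hx : x ∈ Ioo (-m) m)
    (h0 : rimForm hV m hγ.le 1 x = 0) :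
    ∀ᶠ y in 𝓝 x, (x < y → regularFst hV m hγ.le x * rimForm hV m hγ.le 1 y < 0) ∧
      (y < x → 0 < regularFst hV m hγ.le x * rimForm hV m hγ.le 1 y) := by
  have hb := regularFst_ne_zero hV hγ.le h0
  have hbb : ∀ᶠ y in 𝓝 x, 0 < regularFst hV m hγ.le x * regularFst hV m hγ.le y :=
    (continuous_const.mul (continuous_regularFst hV m hγ.le)).continuousAt.eventually
      (lt_mem_nhds (mul_self_pos.2 hb))
  filter_upwards [hbb, eventually_regular_wronskian hV m hγ x, Ioo_mem_nhds hx.1 hx.2] with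
    y hy ⟨K, hK, hW⟩ hym
  have hd : regularSnd hV m hγ.le x = -(regularFst hV m hγ.le x * rimRoot m x) := by
    rw [rimForm] at h0; linarith
  -- Both terms have the sign of `x - y`: the first by Lagrange's identity, the second because
  -- `rimRoot` decreases.
  have key : regularFst hV m hγ.le x * rimForm hV m hγ.le 1 y = (x - y) * K +
      regularFst hV m hγ.le x * regularFst hV m hγ.le y * (rimRoot m y - rimRoot m x) := by
    rw [hd] at hW
    rw [rimForm, ← hW]
    ring
  rw [key]
  constructor
  · intro hxy
    have := mul_pos hy (sub_pos.2 (rimRoot_lt hx hym hxy))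
    nlinarith
  · intro hxy
    have := mul_pos hy (sub_pos.2 (rimRoot_lt hym hx hxy))
    nlinarith

theorem isEigenvalue_iff (hV : V.ConditionA) (hm : 0 < m) (hV0 : V.VanishesBeyond γ)
    (hγ : 0 < γ) {x : ℝ} (hx : x ∈ Ioo (-m) m) :
    V.IsEigenvalue m x ↔ rimForm hV m hγ.le 1 x = 0 := by
  constructor
  · rintro ⟨-, n, hn⟩
    have := (jostForm_eq_zero_of_hasStatePole hV hm hV0 hγ hx (isRimBranch_upper hx) hn).1
    rw [jostForm_neg_rimRatio hV hγ.le hx] at this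
    exact_mod_cast this
  · intro h0
    have hD : jostForm hV m hγ.le (-rimRatio m x) x = 0 := by
      rw [jostForm_neg_rimRatio hV hγ.le hx, h0, Complex.ofReal_zero]
    -- The strict sign to the right of `x` excludes a Jost function vanishing identically near `x`,
    -- so the zero has finite order.
    have htop : analyticOrderAt (fun z => jostForm hV m hγ.le (-rimRatio m z) z) x ≠ ⊤ := by
      intro h
      have hofr : Tendsto (fun y : ℝ => (y : ℂ)) (𝓝 x) (𝓝 (x : ℂ)) :=
        Complex.continuous_ofReal.continuousAt
      have h1 := hofr.eventually (analyticOrderAt_eq_top.1 h)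
      have h2 : ∀ᶠ y in 𝓝 x, x < y → False := by
        filter_upwards [h1, eventually_rimForm_sign hV hγ hx h0, Ioo_mem_nhds hx.1 hx.2] with
          y hy hs hym hxy
        rw [jostForm_neg_rimRatio hV hγ.le hym] at hy
        have h3 := hs.1 hxy
        rw [Complex.ofReal_eq_zero.1 hy, mul_zero] at h3
        exact lt_irrefl _ h3
      obtain ⟨y, hy, hyx⟩ := ((h2.filter_mono nhdsWithin_le_nhds).and
        (self_mem_nhdsWithin : Ioi x ∈ 𝓝[>] x)).exists
      exact hy hyx
    obtain ⟨n, hn⟩ := ENat.ne_top_iff_exists.1 htop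
    exact ⟨hx, n, hasStatePole_of_jostForm_eq_zero hV hm hV0 hγ (isRimBranch_upper hx) hD hn.symm⟩

theorem IsAntiBound.rimForm_eq_zero (hV : V.ConditionA) (hm : 0 < m) (hV0 : V.VanishesBeyond γ)
    (hγ : 0 < γ) {x : ℝ} (h : V.IsAntiBound m x) : rimForm hV m hγ.le (-1) x = 0 := by
  obtain ⟨hx, n, hn⟩ := h
  have := (jostForm_eq_zero_of_hasStatePole hV hm hV0 hγ hx (isRimBranch_lower hx) hn).1
  rw [jostForm_rimRatio hV hγ.le hx] at this
  exact_mod_cast this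

/-- The order of the zero bounds every pole order and is attained by one test function, so it is the
supremum. -/
theorem antiBoundMultiplicity_eq (hV : V.ConditionA) (hm : 0 < m) (hV0 : V.VanishesBeyond γ)
    (hγ : 0 < γ) {x : ℝ} (hx : x ∈ Ioo (-m) m)
    (hD : jostForm hV m hγ.le (rimRatio m x) x = 0) {n : ℕ}
    (hn : analyticOrderAt (fun z => jostForm hV m hγ.le (rimRatio m z) z) x = n) :
    V.IsAntiBound m x ∧ V.antiBoundMultiplicity m x = n := by
  have hp := hasStatePole_of_jostForm_eq_zero hV hm hV0 hγ (isRimBranch_lower hx) hD hn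
  refine ⟨⟨hx, n, hp⟩, le_antisymm (iSup₂_le fun k hk => ?_) (le_iSup₂_of_le n hp le_rfl)⟩
  rw [← hn]
  exact (jostForm_eq_zero_of_hasStatePole hV hm hV0 hγ hx (isRimBranch_lower hx) hk).2

theorem isPreconnected_strip (m : ℝ) : IsPreconnected {z : ℂ | z.re ∈ Ioo (-m) m} :=
  ((convex_Ioo (-m) m).linear_preimage Complex.reLm).isPreconnected

/-- The Jost functions on the lower rim have opposite signs at consecutive eigenvalues. -/
theorem rimForm_mul_neg (hV : V.ConditionA) (hγ : 0 < γ) {x₁ x₂ : ℝ} (h12 : x₁ < x₂)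
    (hx₁ : x₁ ∈ Ioo (-m) m) (hx₂ : x₂ ∈ Ioo (-m) m) (h₁ : rimForm hV m hγ.le 1 x₁ = 0)
    (h₂ : rimForm hV m hγ.le 1 x₂ = 0)
    (hno : ∀ x ∈ Ioo x₁ x₂, rimForm hV m hγ.le 1 x ≠ 0) :
    rimForm hV m hγ.le (-1) x₁ * rimForm hV m hγ.le (-1) x₂ < 0 := by
  have hsub : ∀ x ∈ Ioo x₁ x₂, x ∈ Ioo (-m) m := fun x hx =>
    ⟨hx₁.1.trans hx.1, hx.2.trans hx₂.2⟩
  obtain ⟨y₁, hy₁, hy₁I⟩ := (((eventually_rimForm_sign hV hγ hx₁ h₁).filter_mono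
    nhdsWithin_le_nhds).and (Ioo_mem_nhdsGT h12)).exists
  obtain ⟨y₂, hy₂, hy₂I⟩ := (((eventually_rimForm_sign hV hγ hx₂ h₂).filter_mono
    nhdsWithin_le_nhds).and (Ioo_mem_nhdsLT h12)).exists
  have hs₁ := hy₁.1 hy₁I.1
  have hs₂ := hy₂.2 hy₂I.2
  have hcont : ContinuousOn (rimForm hV m hγ.le 1) (Ioo x₁ x₂) := fun x hx =>
    (continuousAt_rimForm hV hγ.le 1 (hsub x hx)).continuousWithinAt
  have hsame : 0 < rimForm hV m hγ.le 1 y₁ * rimForm hV m hγ.le 1 y₂ := by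
    by_contra! hle
    have h0 : (0 : ℝ) ∈ rimForm hV m hγ.le 1 '' Ioo x₁ x₂ := by
      rcases mul_nonpos_iff.1 hle with h | h
      · exact isPreconnected_Ioo.intermediate_value hy₂I hy₁I hcont ⟨h.2, h.1⟩
      · exact isPreconnected_Ioo.intermediate_value hy₁I hy₂I hcont ⟨h.1, h.2⟩
    obtain ⟨x, hx, hx0⟩ := h0
    exact hno x hx hx0
  -- `F₊` has the same sign at `y₁` and `y₂`, that of `-φ₁` at `x₁` and that of `φ₁` at `x₂`.
  have hbb : regularFst hV m hγ.le x₁ * regularFst hV m hγ.le x₂ < 0 := by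
    by_contra! hge
    nlinarith [mul_neg_of_neg_of_pos hs₁ hs₂, mul_nonneg hge hsame.le]
  have e₁ : rimForm hV m hγ.le (-1) x₁ = -2 * (regularFst hV m hγ.le x₁ * rimRoot m x₁) := by
    rw [rimForm] at h₁ ⊢; linarith
  have e₂ : rimForm hV m hγ.le (-1) x₂ = -2 * (regularFst hV m hγ.le x₂ * rimRoot m x₂) := by
    rw [rimForm] at h₂ ⊢; linarith
  rw [e₁, e₂]
  nlinarith [mul_neg_of_neg_of_pos hbb (mul_pos (rimRoot_pos hx₁) (rimRoot_pos hx₂))]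

end DiracPotential

end

/-! ### Conclusion. -/

open DiracPotential in
theorem theorem1p2 (m : ℝ) (hm : 0 < m) (V : DiracPotential) (hV : V.ConditionA) :
    (∀ x : ℝ, V.IsEigenvalue m x → ¬ V.IsAntiBound m x) ∧
    (∀ x₁ x₂ : ℝ, x₁ < x₂ → V.IsEigenvalue m x₁ → V.IsEigenvalue m x₂ →
      (∀ x ∈ Set.Ioo x₁ x₂, ¬ V.IsEigenvalue m x) →
      ∃ S : Finset ℝ, (∀ x : ℝ, x ∈ S ↔ x ∈ Set.Ioo x₁ x₂ ∧ V.IsAntiBound m x) ∧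
        ∃ N : ℕ, ∑ x ∈ S, V.antiBoundMultiplicity m x = (N : ℕ∞) ∧ Odd N ∧ 1 ≤ N) := by
  obtain ⟨γ, hγ, hV0⟩ := hV.exists_vanishesBeyond
  refine ⟨fun x he ha => ?_, fun x₁ x₂ h12 he₁ he₂ hno => ?_⟩
  · have hx := he.1
    have h1 := (isEigenvalue_iff hV hm hV0 hγ hx).1 he
    have h2 := ha.rimForm_eq_zero hV hm hV0 hγ
    -- Subtracting the conditions on the two rims leaves `2 ρ φ₁ = 0`.
    have h3 : regularFst hV m hγ.le x * rimRoot m x = 0 := by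
      rw [rimForm] at h1 h2; linarith
    exact mul_ne_zero (regularFst_ne_zero hV hγ.le h1) (rimRoot_pos hx).ne' h3
  · have hx₁ := he₁.1
    have hx₂ := he₂.1
    have hsub : ∀ x ∈ Icc x₁ x₂, x ∈ Ioo (-m) m := fun x hx =>
      ⟨hx₁.1.trans_le hx.1, hx.2.trans_lt hx₂.2⟩
    have hneg := rimForm_mul_neg hV hγ h12 hx₁ hx₂ ((isEigenvalue_iff hV hm hV0 hγ hx₁).1 he₁)
      ((isEigenvalue_iff hV hm hV0 hγ hx₂).1 he₂) fun x hx h0 => hno x hx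
        ((isEigenvalue_iff hV hm hV0 hγ (hsub x (Ioo_subset_Icc_self hx))).2 h0)
    obtain ⟨S, r, hS, hr, hodd⟩ := exists_zeros_odd (isPreconnected_strip m)
      (f := fun z => jostForm hV m hγ.le (rimRatio m z) z)
      (fun z hz => analyticAt_jostForm hV m hγ.le (analyticAt_rimRatio hz)) h12.le
      (fun x hx => by simpa using hsub x hx)
      (fun x hx => jostForm_rimRatio hV hγ.le (hsub x hx)) hneg
    have hSx : ∀ x ∈ S, V.IsAntiBound m x ∧ V.antiBoundMultiplicity m x = r x := fun x hx =>
      antiBoundMultiplicity_eq hV hm hV0 hγ (hsub x (Ioo_subset_Icc_self ((hS x).1 hx).1))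
        ((hS x).1 hx).2 (hr x hx)
    refine ⟨S, fun x => ⟨fun hx => ⟨((hS x).1 hx).1, (hSx x hx).1⟩, fun hx => ?_⟩,
      ∑ x ∈ S, r x, ?_, hodd, hodd.pos⟩
    · refine (hS x).2 ⟨hx.1, ?_⟩
      simp only [jostForm_rimRatio hV hγ.le (hsub x (Ioo_subset_Icc_self hx.1)),
        hx.2.rimForm_eq_zero hV hm hV0 hγ, Complex.ofReal_zero]
    · rw [Finset.sum_congr rfl fun x hx => (hSx x hx).2]
      push_cast
      rfl
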